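/- Let $A_\star\in\mathbb R^{d\times d}$ have all its eigenvalues strictly inside the unit disc, let $(w_k)_{k\ge 0}$ be i.i.d. $\mathbb R^d$-valued random vectors with mean zero and $\|w_k\|\le B$ almost surely, and let $Z_{k+1}=A_\star Z_k+w_k$. Write $p(\cdot\mid z)$ for the law of $A_\star z+w_0$, $p^{(k)}$ for the $k$-step kernel, and assume that the chain lives in a compact state space $\mathcal Z\subseteq\{z:\|z\|\le R\}$, i.e. $Z_0\in\mathcal Z$ a.s. and $p(\mathcal Z\mid z)=1$ for all $z\in\mathcal Z$. Let $\pi$ be the stationary distribution of the chain, let $\Sigma=\int zz^\top d\pi(z)$ be positive definite with least eigenvalue $\mu_{\min}$, and let the chain have mixing time $t_{\rm mix}\in\{1,2,\dots\}$, i.e. $$\sup_{z\in\mathcal Z}\ \sup_{S\ \text{measurable}}\bigl|p^{(k)}(S\mid z)-\pi(S)\bigr|\le 2^{-\lfloor k/t_{\rm mix}\rfloor}\qquad\text{for all }k\ge 0 .$$ Let $$\mathcal L(A)=\tfrac12\int\|Az-A_\star z\|^2\,d\pi(z),\qquad A_{k+1}=A_k-\alpha_k\,(A_kZ_k-Z_{k+1})Z_k^\top,\qquad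 \alpha_k=\frac{a}{k+K_0},$$ where $2/\mu_{\min}\le a\le\rho/\mu_{\min}$, the pair $(A_0,Z_0)$ (possibly random) is independent of $(w_k)_{k\ge0}$, and $\mathcal L(A_0)\le D$ a.s. Then there is a constant $C>0$ that depends only on $d,R,B,D,\rho$ (not on $k$, $\delta$, $t_{\rm mix}$, $\mu_{\min}$, $K_0$ or the system) such that the following hold with $$\mathfrak a_5(\delta)=C\,\frac{t_{\rm mix}^2}{\mu_{\min}^3}\,\log^2\!\Bigl(2+\frac{t_{\rm mix}}{\mu_{\min}}\Bigr)\log\frac2\delta,\qquad \mathfrak a_6=C\,\frac{t_{\rm mix}}{\mu_{\min}^3}.$$ (a) For every $\delta\in(0,1)$ and every $K_0>\mathfrak a_5(\delta)$, with probability at least $1-\delta$, $$\mathcal L(A_k)\le C\Bigl(1+\frac{K_0\,\mu_{\min}^2}{t_{\rm mix}^2\log(2/\delta)}\Bigr)\frac{t_{\rm mix}^2\,\log(2k/\delta)}{\mu_{\min}^2\,k}\qquad\text{for all }k\in\{1,2,\dots\}\text{ simultaneously}.$$ (b) For every $K_0>\mathfrak a_6$ and every $k\in\{1,2,\dots\}$,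 $\mathcal L(A_k)$ is integrable and $$\mathbb E[\mathcal L(A_k)]\le C\Bigl(1+\frac{K_0\,\mu_{\min}^2}{t_{\rm mix}}\Bigr)\frac{t_{\rm mix}}{\mu_{\min}^2\,k}.$$ -/

import Mathlib

open MeasureTheory ProbabilityTheory

noncomputable section

/-- The matrix-vector product `A z` on Euclidean space. -/
def matVec {d : ℕ} (A : Matrix (Fin d) (Fin d) ℝ) (z : EuclideanSpace ℝ (Fin d)) :
    EuclideanSpace ℝ (Fin d) :=
  Matrix.toEuclideanLin A z

/-- All complex eigenvalues lie strictly inside the unit disc. -/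
def IsStableMatrix {d : ℕ} (A : Matrix (Fin d) (Fin d) ℝ) : Prop :=
  ∀ l ∈ spectrum ℂ (A.map (algebraMap ℝ ℂ)), ‖l‖ < 1

/-- Trajectory of the linear system `z (k+1) = A (z k) + w k`, `z 0 = z0`. -/
def ldsState {d : ℕ} (A : Matrix (Fin d) (Fin d) ℝ) (z0 : EuclideanSpace ℝ (Fin d))
    (w : ℕ → EuclideanSpace ℝ (Fin d)) : ℕ → EuclideanSpace ℝ (Fin d)
  | 0 => z0
  | k + 1 => matVec A (ldsState A z0 w k) + w k

/-- One-step transition kernel of the linear system whose noise has law `ν`: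
from `z`, the next state is `A z + w` with `w` distributed as `ν`. -/
def ldsKernel {d : ℕ} (A : Matrix (Fin d) (Fin d) ℝ) (ν : Measure (EuclideanSpace ℝ (Fin d))) :
    Kernel (EuclideanSpace ℝ (Fin d)) (EuclideanSpace ℝ (Fin d)) :=
  (Kernel.id ×ₖ Kernel.const _ ν).map (fun q => matVec A q.1 + q.2)

lemma measurable_matVec {d : ℕ} (A : Matrix (Fin d) (Fin d) ℝ) : Measurable (matVec A) :=
  (LinearMap.continuous_of_finiteDimensional (Matrix.toEuclideanLin A)).measurable

lemma ldsKernel_apply {d : ℕ} (A : Matrix (Fin d) (Fin d) ℝ)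
    (ν : Measure (EuclideanSpace ℝ (Fin d))) [IsProbabilityMeasure ν]
    (z : EuclideanSpace ℝ (Fin d)) :
    ldsKernel A ν z = ν.map (fun w => matVec A z + w) := by
  have hm : Measurable (fun q : EuclideanSpace ℝ (Fin d) × EuclideanSpace ℝ (Fin d) =>
      matVec A q.1 + q.2) :=
    ((measurable_matVec A).comp measurable_fst).add measurable_snd
  rw [ldsKernel, Kernel.map_apply _ hm, Kernel.prod_apply, Kernel.id_apply, Kernel.const_apply,
    Measure.dirac_prod, Measure.map_map hm (by fun_prop)]
  rfl

/-- The normalised total variation distance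
`½ |μ - ν|(α) = sup_B |μ B - ν B|` between two measures (used for probability measures). -/
def tvDist {α : Type*} [MeasurableSpace α] (μ ν : Measure α) : ℝ :=
  ⨆ s : {s : Set α // MeasurableSet s}, |μ.real s.1 - ν.real s.1|

/-- On the state space `S`, the chain with kernel `p` is geometrically ergodic in total variation
with limit `π` and mixing time `t`. -/
def HasMixingTime {α : Type*} [MeasurableSpace α] (p : Kernel α α) (S : Set α) (π : Measure α)
    (t : ℕ) : Prop :=
  1 ≤ t ∧ ∀ k : ℕ, ∀ z ∈ S, tvDist ((p ^ k) z) π ≤ (1 / 2 : ℝ) ^ (k / t)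

/-- The loss `½ ∫ ‖A z - A⋆ z‖² dπ(z)`. -/
def sysIdLoss {d : ℕ} (Astar : Matrix (Fin d) (Fin d) ℝ)
    (π : Measure (EuclideanSpace ℝ (Fin d))) (A : Matrix (Fin d) (Fin d) ℝ) : ℝ :=
  (1 / 2) * ∫ z, ‖matVec A z - matVec Astar z‖ ^ 2 ∂π

/-- The second moment matrix `∫ z zᵀ dπ(z)`. -/
def secondMoment {d : ℕ} (π : Measure (EuclideanSpace ℝ (Fin d))) :
    Matrix (Fin d) (Fin d) ℝ :=
  Matrix.of fun i j => ∫ z, z i * z j ∂π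

/-- The SGD iterates `A (k+1) = A k - α_k (A_k z_k - z_{k+1}) z_kᵀ` with `α_k = a / (k + K₀)`,
started at `A0` and run along the observed trajectory `z`. -/
def sysIdSGD {d : ℕ} (a K₀ : ℝ) (A0 : Matrix (Fin d) (Fin d) ℝ)
    (z : ℕ → EuclideanSpace ℝ (Fin d)) : ℕ → Matrix (Fin d) (Fin d) ℝ
  | 0 => A0
  | k + 1 => sysIdSGD a K₀ A0 z k - (a / ((k : ℝ) + K₀)) •
      Matrix.vecMulVec (fun i => (matVec (sysIdSGD a K₀ A0 z k) (z k) - z (k + 1)) i)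
        (fun j => z k j)

end

open scoped RealInnerProductSpace ENNReal

noncomputable section

/-! ### Total variation controls integrals of bounded functions. -/

section TotalVariation

variable {α : Type*} [MeasurableSpace α]

/-! The rows of the error `A_k - A⋆` decouple. With `e` one such row, `z` the current state and `η`
the matching noise coordinate, a step is `e ↦ e - α (⟪e, z⟫ - η) z`, and the loss is the sum over
rows of `½⟪e, Σ e⟫` (`sysIdLoss_eq_sum`, `rowTraj_eq`). Under stationary sampling, the first-order
mean change of this quadratic would be `-α ‖Σ e‖²`, at least a contraction at rate `2αμ`.

The states are correlated in time, so the drift has the bias `⟪Σ e, z⟫⟪e, z⟫ - ‖Σ e‖²`, which is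
`centredForm` at `(Σ e, e)`. It is removed by a Poisson correction. For a linear system the kernel
sends the centred form at `(x, y)` to the centred form at `(Aᵀ x, Aᵀ y)`
(`integral_centredForm_step`), so the Poisson solution is an explicit sum over powers of `Aᵀ`.
Mixing bounds the `k`-th term by `2R² 2^{-⌊k/t⌋}‖x‖‖y‖` (`abs_centredForm_pow_le`), hence the sum by
a multiple `κ = 4R²t`; a finite truncation leaves an error that the drift absorbs
(`exists_driftModel`). The corrected functional `lyap` is within a factor `1 ± 1/10` of the
quadratic and changes by a negative drift, a nearly centred noise, and terms of order `α²κ`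
(`DriftModel.lyap_step_le`).

For the expectation this gives `E V' ≤ (1 - αμ) E V + O(α²κ)`. As `αμ ≥ 2/(k+K₀)`, induction yields
decay like `1/(k+K₀)` (`DriftModel.lintegral_loss_le`).

For the deviation bound, `exp(θ(k+K₀)V_k)` is compensated by `log((k+K₀)/K₀)`. Hoeffding's lemma
bounds the exponential moment of the noise. Its variance proxy is proportional to `‖Σ e‖²`, so the
drift pays for it as long as `‖e‖` is not too large, and this holds as long as the claimed bound has
not yet failed. A maximal inequality localised to that event (`measure_exists_lt_le`) closes the
argument for all times at once (`DriftModel.measure_exists_loss_gt_le`); a union bound over the `d`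
rows finishes. -/

lemma abs_measureReal_sub_le_tvDist (μ ν : Measure α) [IsProbabilityMeasure μ]
    [IsProbabilityMeasure ν] {s : Set α} (hs : MeasurableSet s) :
    |μ.real s - ν.real s| ≤ tvDist μ ν := by
  refine le_ciSup (f := fun s : {s : Set α // MeasurableSet s} => |μ.real s.1 - ν.real s.1|)
    ⟨1, ?_⟩ ⟨s, hs⟩
  rintro _ ⟨s, rfl⟩
  have h1 := measureReal_le_one (μ := μ) (s := s.1)
  have h2 := measureReal_le_one (μ := ν) (s := s.1)
  have h3 := measureReal_nonneg (μ := μ) (s := s.1)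
  have h4 := measureReal_nonneg (μ := ν) (s := s.1)
  exact abs_le.2 ⟨by linarith, by linarith⟩

/-- Layer-cake formula for `f + M`, which takes values in `[0, 2M]`: every superlevel set
contributes at most `tvDist μ ν`, over levels in an interval of length `2M`. -/
lemma abs_integral_sub_le_tvDist (μ ν : Measure α) [IsProbabilityMeasure μ]
    [IsProbabilityMeasure ν] {f : α → ℝ} (hf : Measurable f) {M : ℝ} (hM : ∀ x, |f x| ≤ M) :
    |∫ x, f x ∂μ - ∫ x, f x ∂ν| ≤ 2 * M * tvDist μ ν := by
  have hM0 : 0 ≤ M := by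
    have : Nonempty α := nonempty_of_isProbabilityMeasure μ
    exact (abs_nonneg _).trans (hM (Classical.arbitrary α))
  have key : ∀ (m : Measure α) [IsProbabilityMeasure m],
      Integrable f m ∧ ∫ x, f x ∂m + M = ∫ t in Set.Ioc 0 (2 * M), m.real {a | t ≤ f a + M} := by
    intro m _
    have hi : Integrable f m :=
      Integrable.of_bound hf.aestronglyMeasurable M (ae_of_all _ fun x => by
        simpa using hM x)
    refine ⟨hi, ?_⟩
    have h := Integrable.integral_eq_integral_Ioc_meas_le (μ := m) (f := fun x => f x + M)
      (M := 2 * M) (hi.add (integrable_const _))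
      (ae_of_all _ fun x => by have := (abs_le.1 (hM x)).1; simp; linarith)
      (ae_of_all _ fun x => by have := (abs_le.1 (hM x)).2; simp; linarith)
    rw [← h, integral_add hi (integrable_const _)]
    simp
  have hmeas : ∀ (m : Measure α) [IsProbabilityMeasure m],
      IntegrableOn (fun t : ℝ => m.real {a | t ≤ f a + M}) (Set.Ioc 0 (2 * M)) := by
    intro m _
    have hanti : Antitone (fun t : ℝ => m.real {a | t ≤ f a + M}) := fun s t hst =>
      measureReal_mono fun a (ha : t ≤ f a + M) => hst.trans ha
    exact Measure.integrableOn_of_bounded (M := 1) measure_Ioc_lt_top.ne hanti.measurable.aestronglyMeasurable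
      (ae_of_all _ fun t => by
        rw [Real.norm_of_nonneg measureReal_nonneg]; exact measureReal_le_one)
  have e : ∫ x, f x ∂μ - ∫ x, f x ∂ν = ∫ t in Set.Ioc 0 (2 * M),
      (μ.real {a | t ≤ f a + M} - ν.real {a | t ≤ f a + M}) := by
    rw [integral_sub (hmeas μ) (hmeas ν), ← (key μ).2, ← (key ν).2]
    ring
  rw [e, ← Real.norm_eq_abs]
  refine (norm_setIntegral_le_of_norm_le_const (C := tvDist μ ν) measure_Ioc_lt_top ?_).trans ?_
  · intro t _
    exact abs_measureReal_sub_le_tvDist μ ν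
      (measurableSet_le measurable_const (hf.add_const M))
  · simp [Measure.real, hM0]
    rw [mul_comm]

end TotalVariation

/-! ### The transition kernel, its powers, and the invariance of the state space. -/

section Kernel

variable {d : ℕ}

instance (A : Matrix (Fin d) (Fin d) ℝ) (ν : Measure (EuclideanSpace ℝ (Fin d)))
    [IsProbabilityMeasure ν] : IsMarkovKernel (ldsKernel A ν) := by
  rw [ldsKernel]
  exact Kernel.IsMarkovKernel.map _
    (((measurable_matVec A).comp measurable_fst).add measurable_snd)

lemma integral_ldsKernel (A : Matrix (Fin d) (Fin d) ℝ) (ν : Measure (EuclideanSpace ℝ (Fin d)))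
    [IsProbabilityMeasure ν] (z : EuclideanSpace ℝ (Fin d)) {f : EuclideanSpace ℝ (Fin d) → ℝ}
    (hf : Measurable f) :
    ∫ y, f y ∂(ldsKernel A ν z) = ∫ w, f (matVec A z + w) ∂ν := by
  rw [ldsKernel_apply, integral_map (by fun_prop) hf.aestronglyMeasurable]

lemma ae_ldsKernel_iff (A : Matrix (Fin d) (Fin d) ℝ) (ν : Measure (EuclideanSpace ℝ (Fin d)))
    [IsProbabilityMeasure ν] (z : EuclideanSpace ℝ (Fin d)) {S : Set (EuclideanSpace ℝ (Fin d))}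
    (hS : MeasurableSet S) :
    (∀ᵐ y ∂(ldsKernel A ν z), y ∈ S) ↔ ∀ᵐ w ∂ν, matVec A z + w ∈ S := by
  rw [ldsKernel_apply]
  exact ae_map_iff (by fun_prop) hS

variable {α : Type*} [MeasurableSpace α]

instance Kernel.isMarkovKernel_pow (p : Kernel α α) [IsMarkovKernel p] (k : ℕ) :
    IsMarkovKernel (p ^ k) := by
  induction k with
  | zero => rw [pow_zero]; exact inferInstanceAs (IsMarkovKernel Kernel.id)
  | succ k ih => rw [pow_succ]; exact inferInstanceAs (IsMarkovKernel ((p ^ k) ∘ₖ p))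

lemma Kernel.ae_pow_mem {p : Kernel α α} {S : Set α} (hS : MeasurableSet S)
    (h : ∀ z ∈ S, ∀ᵐ y ∂(p z), y ∈ S) (k : ℕ) {z : α} (hz : z ∈ S) :
    ∀ᵐ y ∂((p ^ k) z), y ∈ S := by
  induction k with
  | zero =>
    rw [pow_zero]
    change ∀ᵐ y ∂(Kernel.id z), y ∈ S
    rw [Kernel.id_apply]
    exact (ae_dirac_iff (p := fun y => y ∈ S) hS).2 hz
  | succ k ih =>
    rw [ae_iff]
    change (p ^ (k + 1)) z Sᶜ = 0
    rw [Kernel.pow_succ_apply_eq_lintegral _ _ _ hS.compl, lintegral_eq_zero_iff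
      (Kernel.measurable_coe _ hS.compl)]
    filter_upwards [ih] with y hy
    exact h y hy

/-- A chain started in `S` stays there, so after `t * n` steps mixing gives `|1 - π(S)| ≤ 2⁻ⁿ` for
every `n`. -/
lemma HasMixingTime.ae_mem {p : Kernel α α} [IsMarkovKernel p] {S : Set α}
    {π : Measure α} [IsProbabilityMeasure π] {t : ℕ} (hmix : HasMixingTime p S π t)
    (hS : MeasurableSet S) (hne : S.Nonempty) (h : ∀ z ∈ S, ∀ᵐ y ∂(p z), y ∈ S) :
    ∀ᵐ z ∂π, z ∈ S := by
  obtain ⟨z, hz⟩ := hne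
  obtain ⟨ht, hm⟩ := hmix
  have hle : ∀ n : ℕ, |1 - π.real S| ≤ (1 / 2 : ℝ) ^ n := by
    intro n
    have h1 := (abs_measureReal_sub_le_tvDist ((p ^ (t * n)) z) π hS).trans (hm (t * n) z hz)
    have h2 : ((p ^ (t * n)) z).real S = 1 := by
      rw [Measure.real, (mem_ae_iff_prob_eq_one hS).1 (Kernel.ae_pow_mem hS h (t * n) hz)]; rfl
    rwa [h2, Nat.mul_div_cancel_left n (by lia)] at h1
  have h0 : |1 - π.real S| ≤ 0 :=
    ge_of_tendsto' (tendsto_pow_atTop_nhds_zero_of_lt_one (by norm_num) (by norm_num)) hle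
  have h1 : π.real S = 1 := by
    have := abs_eq_zero.1 (le_antisymm h0 (abs_nonneg _)); linarith
  exact (mem_ae_iff_prob_eq_one hS).2 ((ENNReal.toReal_eq_one_iff _).1 h1)

end Kernel

end

noncomputable section

/-! ### The second moment operator and the decay of the centred quadratic form along the chain. -/

section SecondMoment

variable {d : ℕ}

/-- The second moment matrix as an operator on Euclidean space. -/
def secondMomentCLM (π : Measure (EuclideanSpace ℝ (Fin d))) :
    EuclideanSpace ℝ (Fin d) →L[ℝ] EuclideanSpace ℝ (Fin d) :=
  Matrix.toEuclideanCLM (𝕜 := ℝ) (secondMoment π)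

/-- The linear map `matVec A` as a continuous linear map. -/
def matCLM (A : Matrix (Fin d) (Fin d) ℝ) :
    EuclideanSpace ℝ (Fin d) →L[ℝ] EuclideanSpace ℝ (Fin d) :=
  (Matrix.toEuclideanLin A).toContinuousLinearMap

lemma matCLM_apply (A : Matrix (Fin d) (Fin d) ℝ) (z : EuclideanSpace ℝ (Fin d)) :
    matCLM A z = matVec A z := rfl

lemma integrable_inner_mul_inner {m : Measure (EuclideanSpace ℝ (Fin d))} [IsFiniteMeasure m]
    {R : ℝ} (hR : ∀ᵐ z ∂m, ‖z‖ ≤ R) (x y : EuclideanSpace ℝ (Fin d)) :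
    Integrable (fun z => ⟪x, z⟫ * ⟪y, z⟫) m := by
  refine Integrable.of_bound (by fun_prop) (‖x‖ * R * (‖y‖ * R)) ?_
  filter_upwards [hR] with z hz
  have h : ∀ x : EuclideanSpace ℝ (Fin d), ‖⟪x, z⟫‖ ≤ ‖x‖ * R := fun x =>
    (norm_inner_le_norm _ _).trans (by gcongr)
  rw [norm_mul]
  exact mul_le_mul (h x) (h y) (norm_nonneg _) ((norm_nonneg _).trans (h x))

lemma integrable_inner {m : Measure (EuclideanSpace ℝ (Fin d))} [IsFiniteMeasure m]
    {R : ℝ} (hR : ∀ᵐ z ∂m, ‖z‖ ≤ R) (x : EuclideanSpace ℝ (Fin d)) :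
    Integrable (fun z => ⟪x, z⟫) m := by
  refine Integrable.of_bound (by fun_prop) (‖x‖ * R) ?_
  filter_upwards [hR] with z hz
  exact (norm_inner_le_norm _ _).trans (by gcongr)

lemma integrable_of_bounded {m : Measure (EuclideanSpace ℝ (Fin d))} [IsFiniteMeasure m]
    {R : ℝ} (hR : ∀ᵐ z ∂m, ‖z‖ ≤ R) : Integrable (fun z => z) m :=
  Integrable.of_bound (by fun_prop) R hR

lemma inner_secondMomentCLM {π : Measure (EuclideanSpace ℝ (Fin d))} [IsFiniteMeasure π]
    {R : ℝ} (hR : ∀ᵐ z ∂π, ‖z‖ ≤ R) (x y : EuclideanSpace ℝ (Fin d)) :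
    ⟪x, secondMomentCLM π y⟫ = ∫ z, ⟪x, z⟫ * ⟪y, z⟫ ∂π := by
  have hc : ∀ i j : Fin d, Integrable (fun z : EuclideanSpace ℝ (Fin d) => z i * z j) π := by
    intro i j
    have := integrable_inner_mul_inner hR (EuclideanSpace.single i (1 : ℝ))
      (EuclideanSpace.single j (1 : ℝ))
    simpa [EuclideanSpace.inner_single_left] using this
  have e : ∀ z : EuclideanSpace ℝ (Fin d),
      ⟪x, z⟫ * ⟪y, z⟫ = ∑ i, ∑ j, x i * y j * (z i * z j) := by
    intro z
    simp only [PiLp.inner_apply, RCLike.inner_apply, conj_trivial, Finset.sum_mul_sum]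
    exact Finset.sum_congr rfl fun i _ => Finset.sum_congr rfl fun j _ => by ring
  simp_rw [e]
  rw [integral_finsetSum _ fun i _ => integrable_finsetSum _ fun j _ => (hc i j).const_mul _]
  simp only [PiLp.inner_apply, RCLike.inner_apply, conj_trivial]
  refine Finset.sum_congr rfl fun i _ => ?_
  rw [integral_finsetSum _ fun j _ => (hc i j).const_mul _]
  have : (secondMomentCLM π y) i = ∑ j, secondMoment π i j * y j := by
    simp [secondMomentCLM, Matrix.ofLp_toEuclideanCLM, Matrix.mulVec, dotProduct]
  rw [this, Finset.sum_mul]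
  refine Finset.sum_congr rfl fun j _ => ?_
  rw [integral_const_mul]
  simp only [secondMoment, Matrix.of_apply]
  ring

lemma secondMomentCLM_symm {π : Measure (EuclideanSpace ℝ (Fin d))} [IsFiniteMeasure π]
    {R : ℝ} (hR : ∀ᵐ z ∂π, ‖z‖ ≤ R) (x y : EuclideanSpace ℝ (Fin d)) :
    ⟪x, secondMomentCLM π y⟫ = ⟪secondMomentCLM π x, y⟫ := by
  rw [real_inner_comm y, inner_secondMomentCLM hR, inner_secondMomentCLM hR]
  simp_rw [mul_comm]

lemma norm_secondMomentCLM_le {π : Measure (EuclideanSpace ℝ (Fin d))} [IsProbabilityMeasure π]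
    {R : ℝ} (hR : ∀ᵐ z ∂π, ‖z‖ ≤ R) (x : EuclideanSpace ℝ (Fin d)) :
    ‖secondMomentCLM π x‖ ≤ R ^ 2 * ‖x‖ := by
  have h : ‖secondMomentCLM π x‖ * ‖secondMomentCLM π x‖ ≤
      (R ^ 2 * ‖x‖) * ‖secondMomentCLM π x‖ := by
    rw [← real_inner_self_eq_norm_mul_norm, inner_secondMomentCLM hR]
    have := norm_integral_le_of_norm_le_const (μ := π)
      (f := fun z => ⟪secondMomentCLM π x, z⟫ * ⟪x, z⟫)
      (C := (‖secondMomentCLM π x‖ * R) * (‖x‖ * R)) (by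
        filter_upwards [hR] with z hz
        have h : ∀ x : EuclideanSpace ℝ (Fin d), ‖⟪x, z⟫‖ ≤ ‖x‖ * R := fun x =>
          (norm_inner_le_norm _ _).trans (by gcongr)
        rw [norm_mul]
        exact mul_le_mul (h _) (h _) (norm_nonneg _) ((norm_nonneg _).trans (h _)))
    rw [probReal_univ, mul_one] at this
    calc _ ≤ _ := le_abs_self _
      _ ≤ _ := this
      _ = _ := by ring
  rcases (norm_nonneg (secondMomentCLM π x)).eq_or_lt with h0 | h0
  · rw [← h0]; positivity
  · exact le_of_mul_le_mul_right h h0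

/-- Subtracting `μ` times the identity shifts the spectrum to the nonnegative half-line, so the
difference is positive semidefinite. -/
lemma le_inner_secondMomentCLM {π : Measure (EuclideanSpace ℝ (Fin d))} {μ : ℝ}
    (hpd : (secondMoment π).PosDef) (hμ : IsLeast (spectrum ℝ (secondMoment π)) μ)
    (x : EuclideanSpace ℝ (Fin d)) : μ * ‖x‖ ^ 2 ≤ ⟪x, secondMomentCLM π x⟫ := by
  have hps : (secondMoment π - algebraMap ℝ (Matrix (Fin d) (Fin d) ℝ) μ).PosSemidef := by
    rw [Matrix.posSemidef_iff_isHermitian_and_spectrum_nonneg]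
    refine ⟨hpd.1.sub (by simp [Matrix.IsHermitian, Algebra.algebraMap_eq_smul_one]), ?_⟩
    intro l hl
    have : l + μ ∈ spectrum ℝ (secondMoment π) := by
      have := spectrum.add_mem_add_iff (s := μ) (r := l)
        (a := secondMoment π - algebraMap ℝ (Matrix (Fin d) (Fin d) ℝ) μ) |>.2 hl
      simpa [add_comm] using this
    have := hμ.2 this
    simpa using this
  have h := hps.dotProduct_mulVec_nonneg (WithLp.ofLp x)
  have e : ⟪x, secondMomentCLM π x⟫ = dotProduct (WithLp.ofLp x)
      (Matrix.mulVec (secondMoment π) (WithLp.ofLp x)) := by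
    simp [secondMomentCLM, PiLp.inner_apply, dotProduct, mul_comm]
  rw [e, EuclideanSpace.real_norm_sq_eq]
  simp only [star_trivial, Matrix.sub_mulVec, dotProduct_sub, Algebra.algebraMap_eq_smul_one,
    Matrix.smul_mulVec, Matrix.one_mulVec, dotProduct_smul, smul_eq_mul] at h
  have e2 : dotProduct (WithLp.ofLp x) (WithLp.ofLp x) = ∑ i, x i ^ 2 := by
    simp [dotProduct, sq]
  rw [e2] at h
  linarith

/-- The centred quadratic form `⟪x, z⟫ ⟪y, z⟫ - ⟪x, Σ y⟫`. -/
def centredForm (Sg : EuclideanSpace ℝ (Fin d) →L[ℝ] EuclideanSpace ℝ (Fin d))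
    (z x y : EuclideanSpace ℝ (Fin d)) : ℝ :=
  ⟪x, z⟫ * ⟪y, z⟫ - ⟪x, Sg y⟫

/-- The class of centred forms is closed under the kernel: cross terms vanish because the noise has
mean zero, and the noise covariance cancels by stationarity. This makes the Poisson equation
explicitly solvable. -/
lemma integral_centredForm_step {A : Matrix (Fin d) (Fin d) ℝ}
    {ν π : Measure (EuclideanSpace ℝ (Fin d))} [IsProbabilityMeasure ν] [IsProbabilityMeasure π]
    {R B : ℝ} (hR : ∀ᵐ z ∂π, ‖z‖ ≤ R) (hB : ∀ᵐ w ∂ν, ‖w‖ ≤ B) (hmean : ∫ w, w ∂ν = 0)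
    (hinv : Kernel.Invariant (ldsKernel A ν) π) (z x y : EuclideanSpace ℝ (Fin d)) :
    ∫ w, centredForm (secondMomentCLM π) (matVec A z + w) x y ∂ν =
      centredForm (secondMomentCLM π) z ((matCLM A).adjoint x) ((matCLM A).adjoint y) := by
  have hzero : ∀ x : EuclideanSpace ℝ (Fin d), ∫ w, ⟪x, w⟫ ∂ν = 0 := by
    intro x
    rw [integral_inner (integrable_of_bounded hB), hmean, inner_zero_right]
  have hadd : ∀ z x w : EuclideanSpace ℝ (Fin d),
      ⟪x, matVec A z + w⟫ = ⟪(matCLM A).adjoint x, z⟫ + ⟪x, w⟫ := by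
    intro z x w
    rw [inner_add_right, ContinuousLinearMap.adjoint_inner_left, matCLM_apply]
  have hstep : ∀ z : EuclideanSpace ℝ (Fin d),
      Integrable (fun w => ⟪x, matVec A z + w⟫ * ⟪y, matVec A z + w⟫) ν ∧
      ∫ w, ⟪x, matVec A z + w⟫ * ⟪y, matVec A z + w⟫ ∂ν =
        ⟪(matCLM A).adjoint x, z⟫ * ⟪(matCLM A).adjoint y, z⟫ + ∫ w, ⟪x, w⟫ * ⟪y, w⟫ ∂ν := by
    intro z
    have e : ∀ w : EuclideanSpace ℝ (Fin d), ⟪x, matVec A z + w⟫ * ⟪y, matVec A z + w⟫ =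
        (⟪(matCLM A).adjoint x, z⟫ * ⟪(matCLM A).adjoint y, z⟫ +
          (⟪(matCLM A).adjoint x, z⟫ * ⟪y, w⟫ + ⟪(matCLM A).adjoint y, z⟫ * ⟪x, w⟫)) +
          ⟪x, w⟫ * ⟪y, w⟫ := by
      intro w; rw [hadd, hadd]; ring
    simp_rw [e]
    have i1 := (integrable_inner hB y).const_mul ⟪(matCLM A).adjoint x, z⟫
    have i2 := (integrable_inner hB x).const_mul ⟪(matCLM A).adjoint y, z⟫
    have i3 := integrable_inner_mul_inner hB x y
    have i4 := (integrable_const (μ := ν)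
      (⟪(matCLM A).adjoint x, z⟫ * ⟪(matCLM A).adjoint y, z⟫)).add (i1.add i2)
    refine ⟨i4.add i3, ?_⟩
    rw [integral_add (by exact i4) i3, integral_add (integrable_const _) (by exact i1.add i2),
      integral_add i1 i2]
    simp [integral_const_mul, hzero]
  -- The stationary covariance equation `Σ = A Σ Aᵀ + Cov(w)`, tested on `x` and `y`; it comes from
  -- integrating `hstep` against the invariant `π`.
  have hstat : ⟪x, secondMomentCLM π y⟫ =
      ⟪(matCLM A).adjoint x, secondMomentCLM π ((matCLM A).adjoint y)⟫ +
        ∫ w, ⟪x, w⟫ * ⟪y, w⟫ ∂ν := by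
    have hm : Measurable (fun z : EuclideanSpace ℝ (Fin d) => ⟪x, z⟫ * ⟪y, z⟫) := by fun_prop
    have hi : Integrable (fun z => ⟪x, z⟫ * ⟪y, z⟫) (π.bind (ldsKernel A ν)) := by
      rw [hinv.def]; exact integrable_inner_mul_inner hR x y
    rw [inner_secondMomentCLM hR, inner_secondMomentCLM hR]
    conv_lhs => rw [← hinv.def]
    rw [Measure.comp_eq_comp_const_apply] at hi ⊢
    rw [Kernel.integral_comp hi, Kernel.const_apply]
    simp_rw [integral_ldsKernel A ν _ hm, fun z => (hstep z).2]
    rw [integral_add (integrable_inner_mul_inner hR _ _) (integrable_const _)]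
    simp
  simp only [centredForm]
  rw [integral_sub (hstep z).1 (integrable_const _), (hstep z).2, hstat]
  simp

lemma integral_centredForm_pow {A : Matrix (Fin d) (Fin d) ℝ}
    {ν π : Measure (EuclideanSpace ℝ (Fin d))} [IsProbabilityMeasure ν] [IsProbabilityMeasure π]
    {R B : ℝ} {S : Set (EuclideanSpace ℝ (Fin d))} (hS : MeasurableSet S)
    (hSR : ∀ z ∈ S, ‖z‖ ≤ R) (hpS : ∀ z ∈ S, ∀ᵐ y ∂(ldsKernel A ν z), y ∈ S)
    (hR : ∀ᵐ z ∂π, ‖z‖ ≤ R) (hB : ∀ᵐ w ∂ν, ‖w‖ ≤ B) (hmean : ∫ w, w ∂ν = 0)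
    (hinv : Kernel.Invariant (ldsKernel A ν) π) (x y : EuclideanSpace ℝ (Fin d)) (k : ℕ)
    {z : EuclideanSpace ℝ (Fin d)} (hz : z ∈ S) :
    ∫ z', centredForm (secondMomentCLM π) z' x y ∂((ldsKernel A ν ^ k) z) =
      centredForm (secondMomentCLM π) z (((matCLM A).adjoint ^ k) x)
        (((matCLM A).adjoint ^ k) y) := by
  have hm : ∀ x y, Measurable (fun z : EuclideanSpace ℝ (Fin d) =>
      centredForm (secondMomentCLM π) z x y) := by
    intro x y; unfold centredForm; fun_prop
  induction k generalizing z with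
  | zero =>
    simp only [pow_zero]
    change ∫ z', centredForm (secondMomentCLM π) z' x y ∂(Kernel.id z) = _
    rw [Kernel.id_apply, integral_dirac]
    rfl
  | succ k ih =>
    have hi : Integrable (fun z' => centredForm (secondMomentCLM π) z' x y)
        (((ldsKernel A ν ^ k) ∘ₖ ldsKernel A ν) z) := by
      change Integrable _ ((ldsKernel A ν ^ k * ldsKernel A ν) z)
      rw [← pow_succ]
      have hb : ∀ᵐ z' ∂((ldsKernel A ν ^ (k + 1)) z), ‖z'‖ ≤ R := by
        filter_upwards [Kernel.ae_pow_mem hS hpS (k + 1) hz] with z' hz' using hSR z' hz'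
      exact (integrable_inner_mul_inner hb x y).sub (integrable_const _)
    rw [pow_succ]
    change ∫ z', _ ∂(((ldsKernel A ν ^ k) ∘ₖ ldsKernel A ν) z) = _
    rw [Kernel.integral_comp hi, integral_congr_ae ((hpS z hz).mono fun z' hz' => ih hz'),
      integral_ldsKernel A ν z (hm _ _), integral_centredForm_step hR hB hmean hinv]
    simp only [pow_succ']
    rfl

/-- The left side is the `k`-step expectation of the centred form at `(x, y)`, whose `π`-mean is
zero, so mixing applies. No decay of the powers of `A` in norm is needed. -/
lemma abs_centredForm_pow_le {A : Matrix (Fin d) (Fin d) ℝ}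
    {ν π : Measure (EuclideanSpace ℝ (Fin d))} [IsProbabilityMeasure ν] [IsProbabilityMeasure π]
    {R B : ℝ} {S : Set (EuclideanSpace ℝ (Fin d))} (hS : MeasurableSet S)
    (hSR : ∀ z ∈ S, ‖z‖ ≤ R) (hpS : ∀ z ∈ S, ∀ᵐ y ∂(ldsKernel A ν z), y ∈ S)
    (hπS : ∀ᵐ z ∂π, z ∈ S) (hB : ∀ᵐ w ∂ν, ‖w‖ ≤ B) (hmean : ∫ w, w ∂ν = 0)
    (hinv : Kernel.Invariant (ldsKernel A ν) π) {t : ℕ}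
    (hmix : HasMixingTime (ldsKernel A ν) S π t) (x y : EuclideanSpace ℝ (Fin d)) (k : ℕ)
    {z : EuclideanSpace ℝ (Fin d)} (hz : z ∈ S) :
    |centredForm (secondMomentCLM π) z (((matCLM A).adjoint ^ k) x)
        (((matCLM A).adjoint ^ k) y)| ≤ 2 * R ^ 2 * (1 / 2 : ℝ) ^ (k / t) * ‖x‖ * ‖y‖ := by
  have hR : ∀ᵐ z ∂π, ‖z‖ ≤ R := hπS.mono hSR
  have hpk := Kernel.ae_pow_mem hS hpS k hz
  have hpR : ∀ᵐ z' ∂((ldsKernel A ν ^ k) z), ‖z'‖ ≤ R := hpk.mono hSR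
  rw [← integral_centredForm_pow hS hSR hpS hR hB hmean hinv x y k hz]
  simp only [centredForm]
  rw [integral_sub (integrable_inner_mul_inner hpR x y) (integrable_const _)]
  rw [inner_secondMomentCLM hR x y, integral_const, probReal_univ, one_smul]
  -- The quadratic is unbounded on the whole space; cutting it off outside `S`, which both measures
  -- ignore, gives the uniform bound the total variation estimate requires.
  set f : EuclideanSpace ℝ (Fin d) → ℝ := S.indicator fun z => ⟪x, z⟫ * ⟪y, z⟫ with hf
  have e : ∀ m : Measure (EuclideanSpace ℝ (Fin d)), (∀ᵐ z ∂m, z ∈ S) →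
      ∫ z, ⟪x, z⟫ * ⟪y, z⟫ ∂m = ∫ z, f z ∂m := by
    intro m hmS
    refine integral_congr_ae (hmS.mono fun z hz => ?_)
    simp [hf, hz]
  rw [e _ hpk, e _ hπS]
  refine (abs_integral_sub_le_tvDist _ _ (M := ‖x‖ * R * (‖y‖ * R))
    (Measurable.indicator (by fun_prop) hS) ?_).trans ?_
  · intro z'
    have hR0 : 0 ≤ R := (norm_nonneg z).trans (hSR z hz)
    by_cases hz' : z' ∈ S
    · simp only [Set.indicator_of_mem hz', abs_mul]
      gcongr
      · exact (abs_real_inner_le_norm _ _).trans (by gcongr; exact hSR z' hz')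
      · exact (abs_real_inner_le_norm _ _).trans (by gcongr; exact hSR z' hz')
    · simp only [Set.indicator_of_notMem hz', abs_zero]; positivity
  · have hR0 : 0 ≤ R := (norm_nonneg z).trans (hSR z hz)
    calc _ ≤ 2 * (‖x‖ * R * (‖y‖ * R)) * (1 / 2 : ℝ) ^ (k / t) := by
          gcongr; exact hmix.2 k z hz
      _ = _ := by ring

/-- Truncated solution of the Poisson equation for `centredForm`. -/
def poissonForm (A : Matrix (Fin d) (Fin d) ℝ)
    (Sg : EuclideanSpace ℝ (Fin d) →L[ℝ] EuclideanSpace ℝ (Fin d)) (N : ℕ)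
    (z x y : EuclideanSpace ℝ (Fin d)) : ℝ :=
  ∑ k ∈ Finset.range N, centredForm Sg z (((matCLM A).adjoint ^ k) x) (((matCLM A).adjoint ^ k) y)

/-- Blocks of length `t` carry a constant exponent, leaving `t` times a geometric series. This is
the source of the single factor `t` in `κ`. -/
lemma sum_half_pow_div_le {t : ℕ} (ht : 1 ≤ t) (n : ℕ) :
    ∑ k ∈ Finset.range (t * n), (1 / 2 : ℝ) ^ (k / t) ≤ 2 * t := by
  have h : ∑ k ∈ Finset.range (t * n), (1 / 2 : ℝ) ^ (k / t) = 2 * t * (1 - (1 / 2) ^ n) := by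
    induction n with
    | zero => simp
    | succ n ih =>
      rw [mul_add, mul_one, Finset.sum_range_add, ih]
      have : ∀ i ∈ Finset.range t, (1 / 2 : ℝ) ^ ((t * n + i) / t) = (1 / 2) ^ n := by
        intro i hi
        rw [Nat.mul_add_div (by lia), Nat.div_eq_of_lt (Finset.mem_range.1 hi), add_zero]
      rw [Finset.sum_congr rfl this]
      simp only [Finset.sum_const, Finset.card_range, nsmul_eq_mul, pow_succ]
      ring
  rw [h]
  have : (0 : ℝ) ≤ 2 * t * (1 / 2) ^ n := by positivity
  linarith

end SecondMoment

end

noncomputable section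

/-! ### One step of the corrected Lyapunov function, in mean and in exponential moment. -/

section OneStep

variable {d : ℕ}

/-- The data of one step of the recursion: `Sg` is the averaged second moment operator, `u` an
approximate solution of the Poisson equation of the chain for `centredForm Sg`. -/
structure DriftModel (A : Matrix (Fin d) (Fin d) ℝ) (ν : Measure (EuclideanSpace ℝ (Fin d)))
    (S : Set (EuclideanSpace ℝ (Fin d)))
    (Sg : EuclideanSpace ℝ (Fin d) →L[ℝ] EuclideanSpace ℝ (Fin d))
    (u : EuclideanSpace ℝ (Fin d) → EuclideanSpace ℝ (Fin d) → EuclideanSpace ℝ (Fin d) → ℝ)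
    (R B μ κ : ℝ) : Prop where
  one_le_R : 1 ≤ R
  one_le_B : 1 ≤ B
  pos : 0 < μ
  le_sq : μ ≤ R ^ 2
  -- `2R²` bounds the centred form on `S`, so `κ` serves for both `u` and `centredForm`.
  two_sq_le : 2 * R ^ 2 ≤ κ
  norm_le : ∀ z ∈ S, ‖z‖ ≤ R
  noise_le : ∀ᵐ w ∂ν, ‖w‖ ≤ B
  noise_mean : ∫ w, w ∂ν = 0
  mem : ∀ z ∈ S, ∀ᵐ w ∂ν, matVec A z + w ∈ S
  symm : ∀ x y, ⟪x, Sg y⟫ = ⟪Sg x, y⟫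
  norm_Sg_le : ∀ x, ‖Sg x‖ ≤ R ^ 2 * ‖x‖
  lower : ∀ x, μ * ‖x‖ ^ 2 ≤ ⟪x, Sg x⟫
  u_bilin : ∀ (z x y x' y' : EuclideanSpace ℝ (Fin d)) (c : ℝ), u z (x - c • x') (y - c • y') =
    u z x y - c * u z x' y - c * u z x y' + c ^ 2 * u z x' y'
  u_cont : Continuous fun p : EuclideanSpace ℝ (Fin d) × EuclideanSpace ℝ (Fin d) ×
    EuclideanSpace ℝ (Fin d) => u p.1 p.2.1 p.2.2
  u_le : ∀ z ∈ S, ∀ x y, |u z x y| ≤ κ * ‖x‖ * ‖y‖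
  -- At `x = Sg e`, `y = e` the tolerance is at most `‖Sg e‖² / 4`, because `μ‖e‖ ≤ ‖Sg e‖`:
  -- truncating the Poisson solution costs a quarter of the drift.
  u_step : ∀ z ∈ S, ∀ x y, |∫ w, u (matVec A z + w) x y ∂ν - (u z x y - centredForm Sg z x y)| ≤
    μ / 4 * ‖x‖ * ‖y‖

/-- Lyapunov function: the quadratic loss with a Markovian correction. -/
def lyap (Sg : EuclideanSpace ℝ (Fin d) →L[ℝ] EuclideanSpace ℝ (Fin d))
    (u : EuclideanSpace ℝ (Fin d) → EuclideanSpace ℝ (Fin d) → EuclideanSpace ℝ (Fin d) → ℝ)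
    (α : ℝ) (e z : EuclideanSpace ℝ (Fin d)) : ℝ :=
  1 / 2 * ⟪e, Sg e⟫ - α * u z (Sg e) e

/-- The (nearly centred) noise in one step of `lyap`. -/
def driftNoise (Sg : EuclideanSpace ℝ (Fin d) →L[ℝ] EuclideanSpace ℝ (Fin d))
    (u : EuclideanSpace ℝ (Fin d) → EuclideanSpace ℝ (Fin d) → EuclideanSpace ℝ (Fin d) → ℝ)
    (α : ℝ) (e z : EuclideanSpace ℝ (Fin d)) (η : ℝ) (z' : EuclideanSpace ℝ (Fin d)) : ℝ :=
  α * (η * ⟪Sg e, z⟫ + (u z (Sg e) e - centredForm Sg z (Sg e) e - u z' (Sg e) e))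

/-- One row of the stochastic gradient step. -/
def rowStep (α : ℝ) (e z : EuclideanSpace ℝ (Fin d)) (η : ℝ) : EuclideanSpace ℝ (Fin d) :=
  e - α • ((⟪e, z⟫ - η) • z)

namespace DriftModel

variable {A : Matrix (Fin d) (Fin d) ℝ} {ν : Measure (EuclideanSpace ℝ (Fin d))}
  {S : Set (EuclideanSpace ℝ (Fin d))}
  {Sg : EuclideanSpace ℝ (Fin d) →L[ℝ] EuclideanSpace ℝ (Fin d)}
  {u : EuclideanSpace ℝ (Fin d) → EuclideanSpace ℝ (Fin d) → EuclideanSpace ℝ (Fin d) → ℝ}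
  {R B μ κ : ℝ}

lemma one_le_κ (h : DriftModel A ν S Sg u R B μ κ) : 1 ≤ κ := by
  have := h.one_le_R
  have := h.two_sq_le
  nlinarith

lemma mul_norm_le (h : DriftModel A ν S Sg u R B μ κ) (e : EuclideanSpace ℝ (Fin d)) :
    μ * ‖e‖ ≤ ‖Sg e‖ := by
  have h1 := (h.lower e).trans (real_inner_le_norm e (Sg e))
  rcases (norm_nonneg e).eq_or_lt with h0 | h0
  · rw [← h0, mul_zero]; positivity
  · exact le_of_mul_le_mul_left (by linarith : ‖e‖ * (μ * ‖e‖) ≤ ‖e‖ * ‖Sg e‖) h0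

lemma mul_inner_le (h : DriftModel A ν S Sg u R B μ κ) (e : EuclideanSpace ℝ (Fin d)) :
    μ * ⟪e, Sg e⟫ ≤ ‖Sg e‖ ^ 2 := by
  have h1 := real_inner_le_norm e (Sg e)
  have h2 := h.mul_norm_le e
  have h3 := h.pos
  nlinarith [norm_nonneg (Sg e)]

lemma inner_nonneg (h : DriftModel A ν S Sg u R B μ κ) (e : EuclideanSpace ℝ (Fin d)) :
    0 ≤ ⟪e, Sg e⟫ := le_trans (by have := h.pos; positivity) (h.lower e)

lemma lyap_step_le (h : DriftModel A ν S Sg u R B μ κ) {e z z' : EuclideanSpace ℝ (Fin d)}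
    {η α α' : ℝ} (hz : z ∈ S) (hz' : z' ∈ S) (hη : |η| ≤ B) (hα' : 0 ≤ α') (hle : α' ≤ α)
    (hα : α ≤ 1) (hd : α - α' ≤ α ^ 2 * μ / 2) :
    lyap Sg u α' (rowStep α e z η) z' ≤ lyap Sg u α e z - α * ‖Sg e‖ ^ 2 +
      α ^ 2 * (7 * κ * R ^ 6 * B ^ 2) * (‖e‖ ^ 2 + 1) + driftNoise Sg u α e z η z' := by
  have hR := h.one_le_R
  have hB := h.one_le_B
  have hκ := h.one_le_κ
  set g := (⟪e, z⟫ - η) • z with hg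
  have hr : rowStep α e z η = e - α • g := rfl
  have hα0 : 0 ≤ α := hα'.trans hle
  have hnz := h.norm_le z hz
  have hG : ‖g‖ ≤ R * (R * ‖e‖ + B) := by
    rw [hg, norm_smul, Real.norm_eq_abs, mul_comm]
    have h1 : |⟪e, z⟫ - η| ≤ R * ‖e‖ + B := by
      refine (abs_sub _ _).trans (add_le_add ?_ hη)
      refine (abs_real_inner_le_norm _ _).trans ?_
      rw [mul_comm]; gcongr
    gcongr
  have hG2 : ‖g‖ ^ 2 ≤ 2 * R ^ 4 * B ^ 2 * (‖e‖ ^ 2 + 1) := by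
    have hR2 : 1 ≤ R ^ 2 := one_le_pow₀ hR
    have hB2 : 1 ≤ B ^ 2 := one_le_pow₀ hB
    calc ‖g‖ ^ 2 ≤ (R * (R * ‖e‖ + B)) ^ 2 := by gcongr
      _ ≤ R ^ 2 * (2 * (R * ‖e‖) ^ 2 + 2 * B ^ 2) := by
          rw [mul_pow]; gcongr; nlinarith [sq_nonneg (R * ‖e‖ - B)]
      _ = 2 * R ^ 4 * 1 * ‖e‖ ^ 2 + 2 * (R ^ 2 * 1) * B ^ 2 := by ring
      _ ≤ 2 * R ^ 4 * B ^ 2 * ‖e‖ ^ 2 + 2 * (R ^ 2 * R ^ 2) * B ^ 2 := by gcongr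
      _ = _ := by ring
  have e1 : ⟪e - α • g, Sg (e - α • g)⟫ =
      ⟪e, Sg e⟫ - 2 * α * ⟪Sg e, g⟫ + α ^ 2 * ⟪g, Sg g⟫ := by
    have hs : ⟪e, Sg g⟫ = ⟪Sg e, g⟫ := h.symm e g
    have hs' : ⟪g, Sg e⟫ = ⟪Sg e, g⟫ := real_inner_comm _ _
    simp only [map_sub, map_smul, inner_sub_left, inner_sub_right, real_inner_smul_left,
      real_inner_smul_right, hs, hs']
    ring
  have e2 : ⟪Sg e, g⟫ = ⟪Sg e, z⟫ * ⟪e, z⟫ - η * ⟪Sg e, z⟫ := by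
    rw [hg, real_inner_smul_right]; ring
  have e3 : u z' (Sg (e - α • g)) (e - α • g) = u z' (Sg e) e - α * u z' (Sg g) e -
      α * u z' (Sg e) g + α ^ 2 * u z' (Sg g) g := by
    rw [map_sub, map_smul, h.u_bilin]
  have hS := h.norm_Sg_le
  have b0 : ⟪g, Sg g⟫ ≤ R ^ 2 * ‖g‖ ^ 2 := by
    refine (real_inner_le_norm _ _).trans ?_
    calc ‖g‖ * ‖Sg g‖ ≤ ‖g‖ * (R ^ 2 * ‖g‖) := by gcongr; exact hS g
      _ = _ := by ring
  have bu : ∀ x y, |u z' (Sg x) y| ≤ κ * R ^ 2 * (‖x‖ * ‖y‖) := by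
    intro x y
    calc _ ≤ κ * ‖Sg x‖ * ‖y‖ := h.u_le z' hz' _ _
      _ ≤ κ * (R ^ 2 * ‖x‖) * ‖y‖ := by gcongr; exact hS x
      _ = _ := by ring
  -- An exact identity: the first-order terms are the drift and `driftNoise`, and everything in the
  -- last bracket is of order `α²`, including the change of step size by `hd`.
  have key : lyap Sg u α' (rowStep α e z η) z' = lyap Sg u α e z - α * ‖Sg e‖ ^ 2 +
      driftNoise Sg u α e z η z' + (α ^ 2 / 2 * ⟪g, Sg g⟫ + (α - α') * u z' (Sg e) e +
        α' * α * (u z' (Sg g) e + u z' (Sg e) g) - α' * α ^ 2 * u z' (Sg g) g) := by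
    rw [hr]
    simp only [lyap, driftNoise, centredForm, e1, e2, e3, real_inner_self_eq_norm_sq]
    ring
  have t1 : (α - α') * u z' (Sg e) e ≤ α ^ 2 * (κ * R ^ 4 * ‖e‖ ^ 2 / 2) := by
    calc (α - α') * u z' (Sg e) e ≤ (α - α') * (κ * R ^ 2 * (‖e‖ * ‖e‖)) := by
          apply mul_le_mul_of_nonneg_left ((le_abs_self _).trans (bu e e)) (by linarith)
      _ ≤ (α ^ 2 * μ / 2) * (κ * R ^ 2 * (‖e‖ * ‖e‖)) := by gcongr
      _ ≤ (α ^ 2 * R ^ 2 / 2) * (κ * R ^ 2 * (‖e‖ * ‖e‖)) := by gcongr; exact h.le_sq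
      _ = _ := by ring
  have t2 : α' * α * (u z' (Sg g) e + u z' (Sg e) g) ≤
      α ^ 2 * (κ * R ^ 2 * (‖g‖ ^ 2 + ‖e‖ ^ 2)) := by
    have h1 : u z' (Sg g) e + u z' (Sg e) g ≤ κ * R ^ 2 * (‖g‖ ^ 2 + ‖e‖ ^ 2) := by
      have h2 := (le_abs_self _).trans (bu g e)
      have h3 := (le_abs_self _).trans (bu e g)
      have h4 : 0 ≤ κ * R ^ 2 * (‖g‖ - ‖e‖) ^ 2 := by positivity
      nlinarith
    calc _ ≤ α' * α * (κ * R ^ 2 * (‖g‖ ^ 2 + ‖e‖ ^ 2)) := by gcongr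
      _ ≤ α * α * (κ * R ^ 2 * (‖g‖ ^ 2 + ‖e‖ ^ 2)) := by gcongr
      _ = _ := by ring
  have t3 : -(α' * α ^ 2 * u z' (Sg g) g) ≤ α ^ 2 * (κ * R ^ 2 * ‖g‖ ^ 2) := by
    have h1 : -u z' (Sg g) g ≤ κ * R ^ 2 * ‖g‖ ^ 2 := by
      have := (neg_le_abs _).trans (bu g g); rw [← sq] at this; exact this
    calc -(α' * α ^ 2 * u z' (Sg g) g) = α' * α ^ 2 * (-u z' (Sg g) g) := by ring
      _ ≤ α' * α ^ 2 * (κ * R ^ 2 * ‖g‖ ^ 2) := by gcongr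
      _ ≤ 1 * α ^ 2 * (κ * R ^ 2 * ‖g‖ ^ 2) := by gcongr; linarith
      _ = _ := by ring
  have t0 : α ^ 2 / 2 * ⟪g, Sg g⟫ ≤ α ^ 2 * (κ * R ^ 2 * ‖g‖ ^ 2 / 2) := by
    calc _ ≤ α ^ 2 / 2 * (1 * (R ^ 2 * ‖g‖ ^ 2)) := by rw [one_mul]; gcongr
      _ ≤ α ^ 2 / 2 * (κ * (R ^ 2 * ‖g‖ ^ 2)) := by gcongr
      _ = _ := by ring
  -- The terms in `‖g‖²` have total weight `5/2`, doubled by `hG2`; those in `‖e‖²` have weight at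
  -- most `3/2`. Altogether `13/2 ≤ 7`.
  have t4 : κ * R ^ 2 * ‖g‖ ^ 2 / 2 + κ * R ^ 4 * ‖e‖ ^ 2 / 2 +
      κ * R ^ 2 * (‖g‖ ^ 2 + ‖e‖ ^ 2) + κ * R ^ 2 * ‖g‖ ^ 2 ≤
      (7 * κ * R ^ 6 * B ^ 2) * (‖e‖ ^ 2 + 1) := by
    have a1 : κ * R ^ 2 * ‖g‖ ^ 2 ≤ κ * R ^ 2 * (2 * R ^ 4 * B ^ 2 * (‖e‖ ^ 2 + 1)) := by gcongr
    have a2 : κ * R ^ 4 * ‖e‖ ^ 2 ≤ κ * R ^ 6 * B ^ 2 * (‖e‖ ^ 2 + 1) := by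
      calc κ * R ^ 4 * ‖e‖ ^ 2 ≤ κ * R ^ 6 * ‖e‖ ^ 2 := by gcongr; norm_num
        _ = κ * R ^ 6 * 1 * ‖e‖ ^ 2 := by ring
        _ ≤ κ * R ^ 6 * B ^ 2 * (‖e‖ ^ 2 + 1) := by
          gcongr
          · exact one_le_pow₀ hB
          · linarith
    have a3 : κ * R ^ 2 * ‖e‖ ^ 2 ≤ κ * R ^ 4 * ‖e‖ ^ 2 := by gcongr; norm_num
    have a4 : 0 ≤ κ * R ^ 6 * B ^ 2 * (‖e‖ ^ 2 + 1) := by positivity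
    linarith
  rw [key]
  have t5 := mul_le_mul_of_nonneg_left t4 (sq_nonneg α)
  linarith

/-- For small steps `20 α κ R² ≤ μ`, so the Poisson correction is at most `μ‖e‖²/20`, a tenth of the
quadratic. Hence `lyap` and the loss are interchangeable up to constants. -/
lemma abs_lyap_sub_le (h : DriftModel A ν S Sg u R B μ κ) {e z : EuclideanSpace ℝ (Fin d)}
    {α : ℝ} (hz : z ∈ S) (hα : 0 ≤ α) (hs : 56 * α * κ * R ^ 6 * B ^ 2 ≤ μ ^ 2) :
    |lyap Sg u α e z - 1 / 2 * ⟪e, Sg e⟫| ≤ 1 / 10 * (1 / 2 * ⟪e, Sg e⟫) := by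
  have hR := h.one_le_R
  have hB := h.one_le_B
  have hκ := h.one_le_κ
  have hμ := h.pos
  have h1 : α * (κ * R ^ 2) * 20 ≤ μ := by
    have a1 : α * κ * R ^ 4 * 20 ≤ μ ^ 2 := by
      refine le_trans ?_ hs
      calc α * κ * R ^ 4 * 20 ≤ α * κ * R ^ 6 * 20 := by gcongr; norm_num
        _ = 20 * α * κ * R ^ 6 * 1 := by ring
        _ ≤ 56 * α * κ * R ^ 6 * B ^ 2 := by
          gcongr
          · norm_num
          · exact one_le_pow₀ hB
    have a2 : (α * (κ * R ^ 2) * 20) * R ^ 2 ≤ μ * R ^ 2 := by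
      calc _ = α * κ * R ^ 4 * 20 := by ring
        _ ≤ μ * μ := by rw [← sq]; exact a1
        _ ≤ μ * R ^ 2 := by gcongr; exact h.le_sq
    exact le_of_mul_le_mul_right a2 (by positivity)
  have h2 : |lyap Sg u α e z - 1 / 2 * ⟪e, Sg e⟫| = α * |u z (Sg e) e| := by
    simp only [lyap, sub_sub_cancel_left, abs_neg, abs_mul, abs_of_nonneg hα]
  rw [h2]
  have h3 : |u z (Sg e) e| ≤ κ * R ^ 2 * ‖e‖ ^ 2 := by
    calc _ ≤ κ * ‖Sg e‖ * ‖e‖ := h.u_le z hz _ _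
      _ ≤ κ * (R ^ 2 * ‖e‖) * ‖e‖ := by gcongr; exact h.norm_Sg_le e
      _ = _ := by ring
  have h4 := h.lower e
  calc α * |u z (Sg e) e| ≤ α * (κ * R ^ 2 * ‖e‖ ^ 2) := by gcongr
    _ = (α * (κ * R ^ 2) * 20) * ‖e‖ ^ 2 / 20 := by ring
    _ ≤ μ * ‖e‖ ^ 2 / 20 := by gcongr
    _ ≤ _ := by linarith

lemma lyap_le (h : DriftModel A ν S Sg u R B μ κ) {e z : EuclideanSpace ℝ (Fin d)}
    {α : ℝ} (hz : z ∈ S) (hα : 0 ≤ α) (hs : 56 * α * κ * R ^ 6 * B ^ 2 ≤ μ ^ 2) :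
    lyap Sg u α e z ≤ 11 / 10 * (1 / 2 * ⟪e, Sg e⟫) := by
  have := (abs_le.1 (h.abs_lyap_sub_le (e := e) hz hα hs)).2; linarith

lemma le_lyap (h : DriftModel A ν S Sg u R B μ κ) {e z : EuclideanSpace ℝ (Fin d)}
    {α : ℝ} (hz : z ∈ S) (hα : 0 ≤ α) (hs : 56 * α * κ * R ^ 6 * B ^ 2 ≤ μ ^ 2) :
    9 / 10 * (1 / 2 * ⟪e, Sg e⟫) ≤ lyap Sg u α e z := by
  have := (abs_le.1 (h.abs_lyap_sub_le (e := e) hz hα hs)).1; linarith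

lemma lyap_nonneg (h : DriftModel A ν S Sg u R B μ κ) {e z : EuclideanSpace ℝ (Fin d)}
    {α : ℝ} (hz : z ∈ S) (hα : 0 ≤ α) (hs : 56 * α * κ * R ^ 6 * B ^ 2 ≤ μ ^ 2) :
    0 ≤ lyap Sg u α e z := by
  have := h.le_lyap (e := e) hz hα hs
  have := h.inner_nonneg e
  linarith

lemma mul_lyap_le (h : DriftModel A ν S Sg u R B μ κ) {e z : EuclideanSpace ℝ (Fin d)}
    {α : ℝ} (hz : z ∈ S) (hα : 0 ≤ α) (hs : 56 * α * κ * R ^ 6 * B ^ 2 ≤ μ ^ 2) :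
    μ * lyap Sg u α e z ≤ 11 / 20 * ‖Sg e‖ ^ 2 := by
  have h1 := mul_le_mul_of_nonneg_left (h.lyap_le (e := e) hz hα hs) h.pos.le
  have h2 := h.mul_inner_le e
  linarith

/-- With `56 = 8 · 7`, the part of the second-order error that grows with `‖e‖²` uses up one eighth
of the drift. -/
lemma smooth_le (h : DriftModel A ν S Sg u R B μ κ) (e : EuclideanSpace ℝ (Fin d))
    {α : ℝ} (hα : 0 ≤ α) (hs : 56 * α * κ * R ^ 6 * B ^ 2 ≤ μ ^ 2) :
    α ^ 2 * (7 * κ * R ^ 6 * B ^ 2) * ‖e‖ ^ 2 ≤ α / 8 * ‖Sg e‖ ^ 2 := by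
  have h1 := h.mul_norm_le e
  have h2 := h.pos
  calc α ^ 2 * (7 * κ * R ^ 6 * B ^ 2) * ‖e‖ ^ 2 =
      α / 8 * ((56 * α * κ * R ^ 6 * B ^ 2) * ‖e‖ ^ 2) := by ring
    _ ≤ α / 8 * (μ ^ 2 * ‖e‖ ^ 2) := by gcongr
    _ = α / 8 * (μ * ‖e‖) ^ 2 := by ring
    _ ≤ _ := by gcongr

lemma abs_driftNoise_le (h : DriftModel A ν S Sg u R B μ κ) {e z z' : EuclideanSpace ℝ (Fin d)}
    {η α : ℝ} (hz : z ∈ S) (hz' : z' ∈ S) (hη : |η| ≤ B) (hα : 0 ≤ α) :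
    |driftNoise Sg u α e z η z'| ≤ α * ‖Sg e‖ * (B * R + 3 * κ * ‖e‖) := by
  have hB := h.one_le_B
  have h1 : |η * ⟪Sg e, z⟫| ≤ B * (‖Sg e‖ * R) := by
    rw [abs_mul]
    gcongr
    exact (abs_real_inner_le_norm _ _).trans (by gcongr; exact h.norm_le z hz)
  have h2 := h.u_le z hz (Sg e) e
  have h3 := h.u_le z' hz' (Sg e) e
  have h4 : |centredForm Sg z (Sg e) e| ≤ κ * ‖Sg e‖ * ‖e‖ := by
    have a1 : |⟪Sg e, z⟫ * ⟪e, z⟫| ≤ (‖Sg e‖ * R) * (‖e‖ * R) := by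
      have hx : ∀ x : EuclideanSpace ℝ (Fin d), |⟪x, z⟫| ≤ ‖x‖ * R := fun x =>
        (abs_real_inner_le_norm _ _).trans (by gcongr; exact h.norm_le z hz)
      rw [abs_mul]
      exact mul_le_mul (hx _) (hx _) (abs_nonneg _) ((abs_nonneg _).trans (hx _))
    have a2 : |⟪Sg e, Sg e⟫| ≤ ‖Sg e‖ * (R ^ 2 * ‖e‖) :=
      (abs_real_inner_le_norm _ _).trans (by gcongr; exact h.norm_Sg_le e)
    calc |centredForm Sg z (Sg e) e| ≤ |⟪Sg e, z⟫ * ⟪e, z⟫| + |⟪Sg e, Sg e⟫| := abs_sub _ _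
      _ ≤ (‖Sg e‖ * R) * (‖e‖ * R) + ‖Sg e‖ * (R ^ 2 * ‖e‖) := add_le_add a1 a2
      _ = (2 * R ^ 2) * ‖Sg e‖ * ‖e‖ := by ring
      _ ≤ _ := by gcongr; exact h.two_sq_le
  rw [driftNoise, abs_mul, abs_of_nonneg hα, mul_assoc]
  gcongr
  calc _ ≤ |η * ⟪Sg e, z⟫| + (|u z (Sg e) e| + |centredForm Sg z (Sg e) e| + |u z' (Sg e) e|) :=
        (abs_add_le _ _).trans (by gcongr; exact (abs_sub _ _).trans (by gcongr; exact abs_sub _ _))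
    _ ≤ B * (‖Sg e‖ * R) + (κ * ‖Sg e‖ * ‖e‖ + κ * ‖Sg e‖ * ‖e‖ + κ * ‖Sg e‖ * ‖e‖) := by gcongr
    _ = _ := by ring

lemma noise_coord_le (h : DriftModel A ν S Sg u R B μ κ) (i : Fin d) :
    ∀ᵐ w ∂ν, |w i| ≤ B := by
  filter_upwards [h.noise_le] with w hw
  exact (PiLp.norm_apply_le w i).trans hw

lemma measurable_driftNoise (h : DriftModel A ν S Sg u R B μ κ) (i : Fin d) (α : ℝ)
    (e z : EuclideanSpace ℝ (Fin d)) :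
    Measurable fun w : EuclideanSpace ℝ (Fin d) =>
      driftNoise Sg u α e z (w i) (matVec A z + w) := by
  have hu : Measurable fun w : EuclideanSpace ℝ (Fin d) => u (matVec A z + w) (Sg e) e :=
    (h.u_cont.comp (by fun_prop : Continuous fun w : EuclideanSpace ℝ (Fin d) =>
      (matVec A z + w, Sg e, e))).measurable
  have hw : Measurable fun w : EuclideanSpace ℝ (Fin d) => w i := by fun_prop
  exact ((hw.mul_const _).add (hu.const_sub _)).const_mul _

lemma abs_driftNoise_ae_le (h : DriftModel A ν S Sg u R B μ κ) (i : Fin d)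
    {e z : EuclideanSpace ℝ (Fin d)} {α : ℝ} (hz : z ∈ S) (hα : 0 ≤ α) :
    ∀ᵐ w ∂ν, |driftNoise Sg u α e z (w i) (matVec A z + w)| ≤
      α * ‖Sg e‖ * (B * R + 3 * κ * ‖e‖) := by
  filter_upwards [h.mem z hz, h.noise_coord_le i] with w hw hi
  exact h.abs_driftNoise_le hz hw hi hα

/-- The gradient noise averages to zero and the Poisson equation cancels the Markovian bias; only
the truncation error of `u_step` survives. -/
lemma integral_driftNoise_le [IsProbabilityMeasure ν] (h : DriftModel A ν S Sg u R B μ κ)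
    (i : Fin d) {e z : EuclideanSpace ℝ (Fin d)} {α : ℝ} (hz : z ∈ S) (hα : 0 ≤ α) :
    ∫ w, driftNoise Sg u α e z (w i) (matVec A z + w) ∂ν ≤ α / 4 * ‖Sg e‖ ^ 2 := by
  have hwi : Integrable (fun w : EuclideanSpace ℝ (Fin d) => w i) ν := by
    refine Integrable.of_bound (by fun_prop) B ?_
    filter_upwards [h.noise_coord_le i] with w hw using hw
  have hmean : ∫ w : EuclideanSpace ℝ (Fin d), w i ∂ν = 0 := by
    have e : ∀ w : EuclideanSpace ℝ (Fin d), w i = ⟪EuclideanSpace.single i (1 : ℝ), w⟫ := by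
      intro w; simp [EuclideanSpace.inner_single_left]
    simp_rw [e]
    rw [integral_inner (integrable_of_bounded h.noise_le), h.noise_mean, inner_zero_right]
  have hum : Measurable fun w : EuclideanSpace ℝ (Fin d) => u (matVec A z + w) (Sg e) e :=
    (h.u_cont.comp (by fun_prop : Continuous fun w : EuclideanSpace ℝ (Fin d) =>
      (matVec A z + w, Sg e, e))).measurable
  have hui : Integrable (fun w => u (matVec A z + w) (Sg e) e) ν := by
    refine Integrable.of_bound hum.aestronglyMeasurable (κ * ‖Sg e‖ * ‖e‖) ?_
    filter_upwards [h.mem z hz] with w hw using h.u_le _ hw _ _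
  have hs := (abs_le.1 (h.u_step z hz (Sg e) e)).1
  have e1 : ∫ w, driftNoise Sg u α e z (w i) (matVec A z + w) ∂ν =
      α * (u z (Sg e) e - centredForm Sg z (Sg e) e - ∫ w, u (matVec A z + w) (Sg e) e ∂ν) := by
    simp only [driftNoise]
    rw [integral_const_mul, integral_add (hwi.mul_const _) (by exact (integrable_const _).sub hui),
      integral_mul_const, hmean, integral_sub (integrable_const _) hui]
    simp
  rw [e1]
  have h1 := h.mul_norm_le e
  have h2 : u z (Sg e) e - centredForm Sg z (Sg e) e - ∫ w, u (matVec A z + w) (Sg e) e ∂ν ≤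
      ‖Sg e‖ ^ 2 / 4 := by
    have : μ / 4 * ‖Sg e‖ * ‖e‖ ≤ ‖Sg e‖ ^ 2 / 4 := by nlinarith [norm_nonneg (Sg e)]
    linarith
  calc _ ≤ α * (‖Sg e‖ ^ 2 / 4) := by gcongr
    _ = _ := by ring

lemma lyap_step_ae_le (h : DriftModel A ν S Sg u R B μ κ) (i : Fin d)
    {e z : EuclideanSpace ℝ (Fin d)} {α α' : ℝ} (hz : z ∈ S) (hα' : 0 ≤ α') (hle : α' ≤ α)
    (hα : α ≤ 1) (hd : α - α' ≤ α ^ 2 * μ / 2) (hs : 56 * α * κ * R ^ 6 * B ^ 2 ≤ μ ^ 2) :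
    ∀ᵐ w ∂ν, lyap Sg u α' (rowStep α e z (w i)) (matVec A z + w) ≤
      lyap Sg u α e z - 7 / 8 * α * ‖Sg e‖ ^ 2 + α ^ 2 * (7 * κ * R ^ 6 * B ^ 2) +
        driftNoise Sg u α e z (w i) (matVec A z + w) := by
  filter_upwards [h.mem z hz, h.noise_coord_le i] with w hw hi
  have h1 := h.lyap_step_le (e := e) hz hw hi hα' hle hα hd
  have h2 := h.smooth_le e (hα'.trans hle) hs
  linarith

lemma continuous_lyap (h : DriftModel A ν S Sg u R B μ κ) (α : ℝ) :
    Continuous fun p : EuclideanSpace ℝ (Fin d) × EuclideanSpace ℝ (Fin d) =>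
      lyap Sg u α p.1 p.2 := by
  have : Continuous fun p : EuclideanSpace ℝ (Fin d) × EuclideanSpace ℝ (Fin d) =>
      u p.2 (Sg p.1) p.1 :=
    h.u_cont.comp (by fun_prop : Continuous fun p : EuclideanSpace ℝ (Fin d) ×
      EuclideanSpace ℝ (Fin d) => (p.2, Sg p.1, p.1))
  have hq : Continuous fun p : EuclideanSpace ℝ (Fin d) × EuclideanSpace ℝ (Fin d) =>
      1 / 2 * ⟪p.1, Sg p.1⟫ := by fun_prop
  exact hq.sub (continuous_const.mul this)

/-- Drift budget: `7/8 - 1/4 = 5/8` of `α‖Sg e‖²` is left, and `αμ · lyap` needs only `11/20` of it.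
-/
lemma lintegral_lyap_step_le [IsProbabilityMeasure ν] (h : DriftModel A ν S Sg u R B μ κ)
    (i : Fin d) {e z : EuclideanSpace ℝ (Fin d)} {α α' : ℝ} (hz : z ∈ S) (hα' : 0 ≤ α')
    (hle : α' ≤ α) (hα : α ≤ 1) (hd : α - α' ≤ α ^ 2 * μ / 2)
    (hs : 56 * α * κ * R ^ 6 * B ^ 2 ≤ μ ^ 2) :
    ∫⁻ w, ENNReal.ofReal (lyap Sg u α' (rowStep α e z (w i)) (matVec A z + w)) ∂ν ≤
      ENNReal.ofReal ((1 - α * μ) * lyap Sg u α e z + α ^ 2 * (7 * κ * R ^ 6 * B ^ 2)) := by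
  have hα0 := hα'.trans hle
  have hκ := h.one_le_κ
  set c := lyap Sg u α e z - 7 / 8 * α * ‖Sg e‖ ^ 2 + α ^ 2 * (7 * κ * R ^ 6 * B ^ 2) with hc
  have hs' : 56 * α' * κ * R ^ 6 * B ^ 2 ≤ μ ^ 2 := by
    refine le_trans ?_ hs
    have := h.one_le_R
    gcongr
  have hX : Integrable (fun w : EuclideanSpace ℝ (Fin d) =>
      driftNoise Sg u α e z (w i) (matVec A z + w)) ν :=
    Integrable.of_bound (h.measurable_driftNoise i α e z).aestronglyMeasurable _
      (h.abs_driftNoise_ae_le i hz hα0)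
  have hnn : ∀ᵐ w ∂ν, 0 ≤ c + driftNoise Sg u α e z (w i) (matVec A z + w) := by
    filter_upwards [h.lyap_step_ae_le i (e := e) hz hα' hle hα hd hs, h.mem z hz] with w hw hm
    exact (h.lyap_nonneg hm hα' hs').trans hw
  calc _ ≤ ∫⁻ w, ENNReal.ofReal (c + driftNoise Sg u α e z (w i) (matVec A z + w)) ∂ν := by
        refine lintegral_mono_ae ?_
        filter_upwards [h.lyap_step_ae_le i (e := e) hz hα' hle hα hd hs] with w hw
        exact ENNReal.ofReal_le_ofReal hw
    _ = ENNReal.ofReal (∫ w, c + driftNoise Sg u α e z (w i) (matVec A z + w) ∂ν) :=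
        (ofReal_integral_eq_lintegral_ofReal ((integrable_const _).add hX) hnn).symm
    _ ≤ _ := by
        refine ENNReal.ofReal_le_ofReal ?_
        rw [integral_add (integrable_const _) hX, integral_const, probReal_univ, one_smul]
        have h1 := h.integral_driftNoise_le i (e := e) hz hα0
        have h2 := mul_le_mul_of_nonneg_left (h.mul_lyap_le (e := e) hz hα0 hs) hα0
        have h3 : 0 ≤ α * ‖Sg e‖ ^ 2 := by positivity
        rw [hc]
        nlinarith

/-- The noise amplitude is proportional to `‖Sg e‖`, so its Hoeffding variance term is a multiple of
the drift; `hsub` makes that multiple `1/8`. Of the `5/8` remaining after the mean, `1/2` is left,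
enough to pay for the weight growing from `l` to `l'`. -/
lemma lintegral_exp_lyap_step_le [IsProbabilityMeasure ν] (h : DriftModel A ν S Sg u R B μ κ)
    (i : Fin d) {e z : EuclideanSpace ℝ (Fin d)} {α α' l l' : ℝ} (hz : z ∈ S) (hα' : 0 ≤ α')
    (hle : α' ≤ α) (hα : α ≤ 1) (hd : α - α' ≤ α ^ 2 * μ / 2)
    (hs : 56 * α * κ * R ^ 6 * B ^ 2 ≤ μ ^ 2) (hl' : 0 ≤ l') (hl : l' - l ≤ l' * α * μ / 2)
    (hsub : l' * α * (B * R + 3 * κ * ‖e‖) ^ 2 ≤ 1 / 4) :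
    ∫⁻ w, ENNReal.ofReal (Real.exp (l' *
        lyap Sg u α' (rowStep α e z (w i)) (matVec A z + w))) ∂ν ≤
      ENNReal.ofReal (Real.exp (l * lyap Sg u α e z +
        l' * (α ^ 2 * (7 * κ * R ^ 6 * B ^ 2)))) := by
  have hα0 := hα'.trans hle
  have hκ := h.one_le_κ
  have hR := h.one_le_R
  have hB := h.one_le_B
  set c := lyap Sg u α e z - 7 / 8 * α * ‖Sg e‖ ^ 2 + α ^ 2 * (7 * κ * R ^ 6 * B ^ 2) with hc
  set X : EuclideanSpace ℝ (Fin d) → ℝ :=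
    fun w => driftNoise Sg u α e z (w i) (matVec A z + w) with hXdef
  set b := α * ‖Sg e‖ * (B * R + 3 * κ * ‖e‖) with hb
  have hb0 : 0 ≤ b := by positivity
  -- Hoeffding's lemma on `[-b, b]`: half the width is `b`, so the variance proxy is `b²`.
  have hsg : HasSubgaussianMGF (fun w => X w - ∫ w, X w ∂ν) ((‖b - (-b)‖₊ / 2) ^ 2) ν :=
    hasSubgaussianMGF_of_mem_Icc (h.measurable_driftNoise i α e z).aemeasurable (by
      filter_upwards [h.abs_driftNoise_ae_le i (e := e) hz hα0] with w hw
      exact abs_le.1 hw)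
  have hpar : (((‖b - (-b)‖₊ / 2) ^ 2 : NNReal) : ℝ) = b ^ 2 := by
    push_cast
    rw [Real.norm_eq_abs, sub_neg_eq_add, abs_of_nonneg (by linarith)]
    ring
  have hmgf := hsg.mgf_le l'
  rw [hpar] at hmgf
  have hint := hsg.integrable_exp_mul l'
  set c' := l' * (c + ∫ w, X w ∂ν) with hc'
  calc _ ≤ ∫⁻ w, ENNReal.ofReal (Real.exp c' *
        Real.exp (l' * (X w - ∫ w, X w ∂ν))) ∂ν := by
        refine lintegral_mono_ae ?_
        filter_upwards [h.lyap_step_ae_le i (e := e) hz hα' hle hα hd hs] with w hw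
        refine ENNReal.ofReal_le_ofReal ?_
        rw [← Real.exp_add, Real.exp_le_exp]
        calc _ ≤ l' * (c + X w) := by gcongr
          _ = _ := by rw [hc']; ring
    _ = ENNReal.ofReal (Real.exp c' * mgf (fun w => X w - ∫ w, X w ∂ν) ν l') := by
        rw [← ofReal_integral_eq_lintegral_ofReal (hint.const_mul _)
          (ae_of_all _ fun w => by positivity), integral_const_mul]
        rfl
    _ ≤ ENNReal.ofReal (Real.exp c' * Real.exp (b ^ 2 * l' ^ 2 / 2)) := by gcongr
    _ ≤ _ := by
        rw [← Real.exp_add]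
        refine ENNReal.ofReal_le_ofReal (Real.exp_le_exp.2 ?_)
        have h1 := mul_le_mul_of_nonneg_left (h.integral_driftNoise_le i (e := e) hz hα0) hl'
        have h2 := mul_le_mul_of_nonneg_left (h.mul_lyap_le (e := e) hz hα0 hs)
          (mul_nonneg hl' hα0)
        have h3 : b ^ 2 * l' ^ 2 / 2 ≤ l' * α * ‖Sg e‖ ^ 2 / 8 := by
          have := mul_le_mul_of_nonneg_left hsub
            (by positivity : 0 ≤ l' * α * ‖Sg e‖ ^ 2 / 2)
          calc _ = l' * α * ‖Sg e‖ ^ 2 / 2 * (l' * α * (B * R + 3 * κ * ‖e‖) ^ 2) := by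
                rw [hb]; ring
            _ ≤ _ := this
            _ = _ := by ring
        have h4 := mul_le_mul_of_nonneg_right hl (h.lyap_nonneg (e := e) hz hα0 hs)
        have h5 : 0 ≤ l' * α * ‖Sg e‖ ^ 2 := by positivity
        rw [hc', hc]
        simp only [hXdef]
        nlinarith

end DriftModel

end OneStep

end

noncomputable section

/-! ### Conditioning on the past by Fubini, and a localised maximal inequality. -/

section History

variable {Ω : Type*} [MeasurableSpace Ω] {P : Measure Ω} [IsProbabilityMeasure P]
  {E : Type*} [MeasurableSpace E] [Zero E] {𝒳 : Type*} [MeasurableSpace 𝒳]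

/-- The first `k` terms of a sequence, extended by zero. -/
def truncSeq (k : ℕ) (v : ℕ → E) : ℕ → E := fun j => if j < k then v j else 0

lemma measurable_truncSeq (k : ℕ) : Measurable (truncSeq k : (ℕ → E) → ℕ → E) := by
  refine measurable_pi_lambda _ fun j => ?_
  unfold truncSeq
  split_ifs
  · exact measurable_pi_apply j
  · exact measurable_const

/-- The initial data, the past noise and the fresh noise are jointly independent. Truncating by zero
keeps the past in a fixed space for every `k`. -/
lemma map_history_eq_prod {w : ℕ → Ω → E} {X : Ω → 𝒳} (hw : ∀ k, Measurable (w k))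
    (hind : iIndepFun w P) (hid : ∀ k, IdentDistrib (w k) (w 0) P P) (hX : Measurable X)
    (hXw : IndepFun X (fun ω k => w k ω) P) (k : ℕ) :
    P.map (fun ω => ((X ω, truncSeq k (fun j => w j ω)), w k ω)) =
      (P.map fun ω => (X ω, truncSeq k (fun j => w j ω))).prod (P.map (w 0)) := by
  have hY : Measurable fun ω => fun j => w j ω := measurable_pi_lambda _ hw
  have hT : Measurable fun ω => truncSeq k (fun j => w j ω) := (measurable_truncSeq k).comp hY
  have hTW : IndepFun (fun ω => truncSeq k (fun j => w j ω)) (w k) P := by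
    have h1 := hind.indepFun_finset (Finset.range k) {k} (by simp) hw
    let φ : (Finset.range k → E) → ℕ → E := fun f j =>
      if h : j ∈ Finset.range k then f ⟨j, h⟩ else 0
    have hφ : Measurable φ := by
      refine measurable_pi_lambda _ fun j => ?_
      by_cases h : j ∈ Finset.range k
      · simp only [φ, h, dite_true]; exact measurable_pi_apply _
      · simp only [φ, h, dite_false]; exact measurable_const
    have h2 := h1.comp hφ (measurable_pi_apply (⟨k, by simp⟩ : ({k} : Finset ℕ)))
    convert! h2 using 1
    ext ω j
    simp only [truncSeq, φ, Function.comp, Finset.mem_range]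
    split_ifs <;> rfl
  have h3 : IndepFun X (fun ω => (truncSeq k (fun j => w j ω), w k ω)) P :=
    hXw.comp measurable_id ((measurable_truncSeq k).prodMk (measurable_pi_apply k))
  have h4 : IndepFun X (fun ω => truncSeq k (fun j => w j ω)) P :=
    hXw.comp measurable_id (measurable_truncSeq k)
  have e3 := h3.map_prod_eq_prod_map_map hX.aemeasurable (hT.prodMk (hw k)).aemeasurable
  have e4 := h4.map_prod_eq_prod_map_map hX.aemeasurable hT.aemeasurable
  have e5 := hTW.map_prod_eq_prod_map_map hT.aemeasurable (hw k).aemeasurable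
  have : IsProbabilityMeasure (P.map X) := Measure.isProbabilityMeasure_map hX.aemeasurable
  have : IsProbabilityMeasure (P.map (w k)) :=
    Measure.isProbabilityMeasure_map (hw k).aemeasurable
  have : IsProbabilityMeasure (P.map fun ω => truncSeq k (fun j => w j ω)) :=
    Measure.isProbabilityMeasure_map hT.aemeasurable
  rw [← (hid k).map_eq, e4]
  have e6 := (measurePreserving_prodAssoc (P.map X)
    (P.map fun ω => truncSeq k (fun j => w j ω)) (P.map (w k))).symm MeasurableEquiv.prodAssoc
  rw [← e6.map_eq, ← e5, ← e3, Measure.map_map (MeasurableEquiv.measurable _)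
    (hX.prodMk (hT.prodMk (hw k)))]
  rfl

lemma lintegral_history {w : ℕ → Ω → E} {X : Ω → 𝒳} (hw : ∀ k, Measurable (w k))
    (hind : iIndepFun w P) (hid : ∀ k, IdentDistrib (w k) (w 0) P P) (hX : Measurable X)
    (hXw : IndepFun X (fun ω k => w k ω) P) (k : ℕ) {F : (𝒳 × (ℕ → E)) × E → ℝ≥0∞}
    (hF : Measurable F) :
    ∫⁻ ω, F ((X ω, truncSeq k (fun j => w j ω)), w k ω) ∂P =
      ∫⁻ ω, ∫⁻ x, F ((X ω, truncSeq k (fun j => w j ω)), x) ∂(P.map (w 0)) ∂P := by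
  have hH : Measurable fun ω => (X ω, truncSeq k (fun j => w j ω)) :=
    hX.prodMk ((measurable_truncSeq k).comp (measurable_pi_lambda _ hw))
  have : IsProbabilityMeasure (P.map (w 0)) :=
    Measure.isProbabilityMeasure_map (hw 0).aemeasurable
  rw [← lintegral_map (g := fun ω => ((X ω, truncSeq k (fun j => w j ω)), w k ω)) hF
    (hH.prodMk (hw k)), map_history_eq_prod hw hind hid hX hXw k, lintegral_prod _ hF.aemeasurable,
    lintegral_map hF.lintegral_prod_right' hH]

/-- Maximal inequality for exponential supermartingales localised to the event that no earlier
violation has occurred. -/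
lemma measure_exists_lt_le {V : ℕ → Ω → ℝ} (hV : ∀ k, Measurable (V k)) (s : ℕ → ℝ) (b : ℝ)
    (hstep : ∀ k, ∫⁻ ω in {ω | ∀ j ≤ k, V j ω ≤ b + s j},
        ENNReal.ofReal (Real.exp (V (k + 1) ω - s (k + 1))) ∂P ≤
      ∫⁻ ω in {ω | ∀ j ≤ k, V j ω ≤ b + s j}, ENNReal.ofReal (Real.exp (V k ω - s k)) ∂P) :
    P {ω | ∃ k, b + s k < V k ω} ≤
      ENNReal.ofReal (Real.exp (-b)) * ∫⁻ ω, ENNReal.ofReal (Real.exp (V 0 ω - s 0)) ∂P := by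
  set G : ℕ → Set Ω := fun k => {ω | ∀ j ≤ k, V j ω ≤ b + s j} with hG
  have hGm : ∀ k, MeasurableSet (G k) := fun k => by
    have : G k = ⋂ j, ⋂ _ : j ≤ k, {ω | V j ω ≤ b + s j} := by ext; simp [hG]
    rw [this]
    exact MeasurableSet.iInter fun j => MeasurableSet.iInter fun _ =>
      measurableSet_le (hV j) measurable_const
  have hGs : ∀ k, G (k + 1) ⊆ G k := fun k ω h j hj => h j (by lia)
  set Y : ℕ → Ω → ℝ≥0∞ := fun k ω => ENNReal.ofReal (Real.exp (V k ω - s k)) with hY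
  have hYm : ∀ k, Measurable (Y k) := fun k => by
    exact ENNReal.measurable_ofReal.comp (Real.measurable_exp.comp ((hV k).sub_const _))
  set c := ENNReal.ofReal (Real.exp b) with hc
  have hbad : ∀ k ω, b + s k < V k ω → c ≤ Y k ω := fun k ω h =>
    ENNReal.ofReal_le_ofReal (Real.exp_le_exp.2 (by linarith))
  -- Optional stopping without stopping times: paths that violate the bound for the first time leave
  -- `G` carrying `Y ≥ c`, and their mass is charged to the first summand.
  have key : ∀ k, c * P (G k)ᶜ + ∫⁻ ω in G k, Y k ω ∂P ≤ ∫⁻ ω, Y 0 ω ∂P := by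
    intro k
    induction k with
    | zero =>
      rw [← lintegral_add_compl (μ := P) (Y 0) (hGm 0).compl, compl_compl]
      gcongr
      rw [← setLIntegral_const]
      refine setLIntegral_mono (hYm 0) fun ω hω => hbad 0 ω ?_
      by_contra hcon
      exact hω fun j hj => by obtain rfl : j = 0 := by lia
                              exact not_lt.1 hcon
    | succ k ih =>
      refine le_trans ?_ ih
      have hsplit : (G (k + 1))ᶜ = (G k)ᶜ ∪ (G k \ G (k + 1)) := by
        ext ω
        have := @hGs k ω
        simp only [Set.mem_compl_iff, Set.mem_union, Set.mem_sdiff]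
        tauto
      have h1 : P (G (k + 1))ᶜ ≤ P (G k)ᶜ + P (G k \ G (k + 1)) := by
        rw [hsplit]; exact measure_union_le _ _
      have h2 : c * P (G k \ G (k + 1)) + ∫⁻ ω in G (k + 1), Y (k + 1) ω ∂P ≤
          ∫⁻ ω in G k, Y k ω ∂P := by
        refine le_trans ?_ (hstep k)
        rw [← lintegral_inter_add_sdiff (Y (k + 1)) (G k) (hGm (k + 1)),
          Set.inter_eq_right.2 (hGs k), add_comm]
        gcongr
        rw [← setLIntegral_const]
        refine setLIntegral_mono (hYm _) fun ω hω => hbad (k + 1) ω ?_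
        by_contra hcon
        refine hω.2 fun j hj => ?_
        rcases Nat.lt_or_ge j (k + 1) with hlt | hge
        · exact hω.1 j (by lia)
        · obtain rfl : j = k + 1 := by lia
          exact not_lt.1 hcon
      calc _ ≤ c * (P (G k)ᶜ + P (G k \ G (k + 1))) + ∫⁻ ω in G (k + 1), Y (k + 1) ω ∂P := by
            gcongr
        _ = c * P (G k)ᶜ + (c * P (G k \ G (k + 1)) + ∫⁻ ω in G (k + 1), Y (k + 1) ω ∂P) := by
            rw [mul_add, add_assoc]
        _ ≤ _ := by gcongr
  have hc1 : ENNReal.ofReal (Real.exp (-b)) * c = 1 := by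
    rw [hc, ← ENNReal.ofReal_mul (by positivity), ← Real.exp_add]; simp
  have hk : ∀ k, P (G k)ᶜ ≤ ENNReal.ofReal (Real.exp (-b)) * ∫⁻ ω, Y 0 ω ∂P := by
    intro k
    calc P (G k)ᶜ = ENNReal.ofReal (Real.exp (-b)) * (c * P (G k)ᶜ) := by
          rw [← mul_assoc, hc1, one_mul]
      _ ≤ _ := by gcongr; exact le_self_add.trans (key k)
  have hU : {ω | ∃ k, b + s k < V k ω} = ⋃ k, (G k)ᶜ := by
    ext ω
    simp only [hG, Set.mem_ofPred_eq, Set.mem_iUnion, Set.mem_compl_iff, not_forall, not_le]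
    exact ⟨fun ⟨k, h⟩ => ⟨k, k, le_rfl, h⟩, fun ⟨_, j, _, h⟩ => ⟨j, h⟩⟩
  rw [hU, Monotone.measure_iUnion (monotone_nat_of_le_succ fun k =>
    Set.compl_subset_compl.2 (hGs k))]
  exact iSup_le hk

end History

/-! ### The Markov recursion of one row together with the state. -/

section Row

variable {d : ℕ}

/-- Joint trajectory of one row of the iterates and of the state. -/
def rowTraj (A : Matrix (Fin d) (Fin d) ℝ) (α : ℕ → ℝ) (i : Fin d)
    (x : EuclideanSpace ℝ (Fin d) × EuclideanSpace ℝ (Fin d)) (v : ℕ → EuclideanSpace ℝ (Fin d)) :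
    ℕ → EuclideanSpace ℝ (Fin d) × EuclideanSpace ℝ (Fin d)
  | 0 => x
  | k + 1 => (rowStep (α k) (rowTraj A α i x v k).1 (rowTraj A α i x v k).2 (v k i),
      matVec A (rowTraj A α i x v k).2 + v k)

/-- One step of `rowTraj` as a function of the current state and noise. -/
def rowNext (A : Matrix (Fin d) (Fin d) ℝ) (α : ℝ) (i : Fin d)
    (p : EuclideanSpace ℝ (Fin d) × EuclideanSpace ℝ (Fin d)) (x : EuclideanSpace ℝ (Fin d)) :
    EuclideanSpace ℝ (Fin d) × EuclideanSpace ℝ (Fin d) :=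
  (rowStep α p.1 p.2 (x i), matVec A p.2 + x)

lemma rowTraj_succ (A : Matrix (Fin d) (Fin d) ℝ) (α : ℕ → ℝ) (i : Fin d)
    (x : EuclideanSpace ℝ (Fin d) × EuclideanSpace ℝ (Fin d)) (v : ℕ → EuclideanSpace ℝ (Fin d))
    (k : ℕ) : rowTraj A α i x v (k + 1) = rowNext A (α k) i (rowTraj A α i x v k) (v k) := rfl

lemma measurable_rowNext (A : Matrix (Fin d) (Fin d) ℝ) (α : ℝ) (i : Fin d) :
    Measurable fun q : (EuclideanSpace ℝ (Fin d) × EuclideanSpace ℝ (Fin d)) ×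
      EuclideanSpace ℝ (Fin d) => rowNext A α i q.1 q.2 := by
  have h : Measurable fun q : (EuclideanSpace ℝ (Fin d) × EuclideanSpace ℝ (Fin d)) ×
      EuclideanSpace ℝ (Fin d) => matVec A q.1.2 :=
    (measurable_matVec A).comp (measurable_snd.comp measurable_fst)
  unfold rowNext rowStep
  fun_prop

lemma measurable_rowTraj (A : Matrix (Fin d) (Fin d) ℝ) (α : ℕ → ℝ) (i : Fin d) (k : ℕ) :
    Measurable fun p : (EuclideanSpace ℝ (Fin d) × EuclideanSpace ℝ (Fin d)) ×
      (ℕ → EuclideanSpace ℝ (Fin d)) => rowTraj A α i p.1 p.2 k := by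
  induction k with
  | zero => exact measurable_fst
  | succ k ih =>
    exact (measurable_rowNext A (α k) i).comp
      (ih.prodMk ((measurable_pi_apply k).comp measurable_snd))

lemma rowTraj_truncSeq (A : Matrix (Fin d) (Fin d) ℝ) (α : ℕ → ℝ) (i : Fin d)
    (x : EuclideanSpace ℝ (Fin d) × EuclideanSpace ℝ (Fin d)) (v : ℕ → EuclideanSpace ℝ (Fin d))
    {k m : ℕ} (hkm : k ≤ m) : rowTraj A α i x (truncSeq m v) k = rowTraj A α i x v k := by
  induction k with
  | zero => rfl
  | succ k ih =>
    rw [rowTraj_succ, rowTraj_succ, ih (by lia)]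
    simp [truncSeq, show k < m by lia]

variable {Ω : Type*} [MeasurableSpace Ω] {P : Measure Ω} [IsProbabilityMeasure P]

/-- Noise and initial condition of the recursion. -/
structure NoiseModel (P : Measure Ω) (w : ℕ → Ω → EuclideanSpace ℝ (Fin d))
    (X : Ω → EuclideanSpace ℝ (Fin d) × EuclideanSpace ℝ (Fin d)) : Prop where
  meas : ∀ k, Measurable (w k)
  indep : iIndepFun w P
  ident : ∀ k, IdentDistrib (w k) (w 0) P P
  meas_init : Measurable X
  indep_init : IndepFun X (fun ω k => w k ω) P

namespace NoiseModel

variable {w : ℕ → Ω → EuclideanSpace ℝ (Fin d)}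
  {X : Ω → EuclideanSpace ℝ (Fin d) × EuclideanSpace ℝ (Fin d)}

lemma measurable_traj (hN : NoiseModel P w X) (A : Matrix (Fin d) (Fin d) ℝ) (α : ℕ → ℝ)
    (i : Fin d) (k : ℕ) : Measurable fun ω => rowTraj A α i (X ω) (fun j => w j ω) k :=
  (measurable_rowTraj A α i k).comp (hN.meas_init.prodMk (measurable_pi_lambda _ hN.meas))

/-- The Markov property restricted to a past event: `hGk` says that `G` sees only the first `k`
noise terms, so `w k` can be integrated out separately. -/
lemma setLIntegral_step (hN : NoiseModel P w X) (A : Matrix (Fin d) (Fin d) ℝ) (α : ℕ → ℝ)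
    (i : Fin d) (k : ℕ) {G : Set ((EuclideanSpace ℝ (Fin d) × EuclideanSpace ℝ (Fin d)) ×
      (ℕ → EuclideanSpace ℝ (Fin d)))} (hG : MeasurableSet G)
    (hGk : ∀ x v, (x, truncSeq k v) ∈ G ↔ (x, v) ∈ G)
    {Φ : EuclideanSpace ℝ (Fin d) × EuclideanSpace ℝ (Fin d) → ℝ≥0∞} (hΦ : Measurable Φ) :
    ∫⁻ ω in {ω | (X ω, fun j => w j ω) ∈ G}, Φ (rowTraj A α i (X ω) (fun j => w j ω) (k + 1)) ∂P =
      ∫⁻ ω in {ω | (X ω, fun j => w j ω) ∈ G},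
        ∫⁻ x, Φ (rowNext A (α k) i (rowTraj A α i (X ω) (fun j => w j ω) k) x) ∂(P.map (w 0))
          ∂P := by
  have hm : MeasurableSet {ω | (X ω, fun j => w j ω) ∈ G} :=
    (hN.meas_init.prodMk (measurable_pi_lambda _ hN.meas)) hG
  let F : ((EuclideanSpace ℝ (Fin d) × EuclideanSpace ℝ (Fin d)) ×
      (ℕ → EuclideanSpace ℝ (Fin d))) × EuclideanSpace ℝ (Fin d) → ℝ≥0∞ := fun q =>
    (Prod.fst ⁻¹' G).indicator (fun q => Φ (rowNext A (α k) i (rowTraj A α i q.1.1 q.1.2 k) q.2)) q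
  have hF : Measurable F := by
    refine Measurable.indicator ?_ (measurable_fst hG)
    exact hΦ.comp ((measurable_rowNext A (α k) i).comp
      (((measurable_rowTraj A α i k).comp measurable_fst).prodMk measurable_snd))
  have h := lintegral_history hN.meas hN.indep hN.ident hN.meas_init hN.indep_init k hF
  rw [← lintegral_indicator hm, ← lintegral_indicator hm]
  convert! h using 1
  · refine lintegral_congr fun ω => ?_
    by_cases hω : (X ω, fun j => w j ω) ∈ G
    · have h2 := (hGk (X ω) fun j => w j ω).2 hω
      simp only [F, Set.indicator, Set.mem_ofPred_eq, Set.mem_preimage, hω, h2, if_true,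
        rowTraj_truncSeq A α i _ _ le_rfl, rowTraj_succ]
    · have h2 := (hGk (X ω) fun j => w j ω).not.2 hω
      simp only [F, Set.indicator, Set.mem_ofPred_eq, Set.mem_preimage, hω, h2, if_false]
  · refine lintegral_congr fun ω => ?_
    by_cases hω : (X ω, fun j => w j ω) ∈ G
    · have h2 := (hGk (X ω) fun j => w j ω).2 hω
      simp only [F, Set.indicator, Set.mem_ofPred_eq, Set.mem_preimage, hω, h2, if_true,
        rowTraj_truncSeq A α i _ _ le_rfl]
    · have h2 := (hGk (X ω) fun j => w j ω).not.2 hω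
      simp only [F, Set.indicator, Set.mem_ofPred_eq, Set.mem_preimage, hω, h2, if_false,
        lintegral_zero]

lemma lintegral_step (hN : NoiseModel P w X) (A : Matrix (Fin d) (Fin d) ℝ) (α : ℕ → ℝ)
    (i : Fin d) (k : ℕ)
    {Φ : EuclideanSpace ℝ (Fin d) × EuclideanSpace ℝ (Fin d) → ℝ≥0∞} (hΦ : Measurable Φ) :
    ∫⁻ ω, Φ (rowTraj A α i (X ω) (fun j => w j ω) (k + 1)) ∂P =
      ∫⁻ ω, ∫⁻ x, Φ (rowNext A (α k) i (rowTraj A α i (X ω) (fun j => w j ω) k) x)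
        ∂(P.map (w 0)) ∂P := by
  simpa using hN.setLIntegral_step A α i k MeasurableSet.univ (by simp) hΦ

lemma ae_mem (hN : NoiseModel P w X) {A : Matrix (Fin d) (Fin d) ℝ} (α : ℕ → ℝ) (i : Fin d)
    {S : Set (EuclideanSpace ℝ (Fin d))} (hS : MeasurableSet S)
    (hmem : ∀ z ∈ S, ∀ᵐ x ∂(P.map (w 0)), matVec A z + x ∈ S) (h0 : ∀ᵐ ω ∂P, (X ω).2 ∈ S)
    (k : ℕ) : ∀ᵐ ω ∂P, (rowTraj A α i (X ω) (fun j => w j ω) k).2 ∈ S := by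
  induction k with
  | zero => exact h0
  | succ k ih =>
    have hm : MeasurableSet {p : EuclideanSpace ℝ (Fin d) × EuclideanSpace ℝ (Fin d) | p.2 ∉ S} :=
      measurable_snd hS.compl
    have h := hN.lintegral_step A α i k
      (Φ := {p | p.2 ∉ S}.indicator 1) (measurable_one.indicator hm)
    have hz : ∫⁻ ω, ∫⁻ x, ({p : EuclideanSpace ℝ (Fin d) × EuclideanSpace ℝ (Fin d) |
        p.2 ∉ S}.indicator 1 : _ → ℝ≥0∞) (rowNext A (α k) i
          (rowTraj A α i (X ω) (fun j => w j ω) k) x) ∂(P.map (w 0)) ∂P = 0 := by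
      rw [lintegral_eq_zero_of_ae_eq_zero]
      filter_upwards [ih] with ω hω
      refine lintegral_eq_zero_of_ae_eq_zero ?_
      filter_upwards [hmem _ hω] with x hx
      simp [Set.indicator, rowNext, hx]
    rw [hz] at h
    have hmm : Measurable fun ω => ({p : EuclideanSpace ℝ (Fin d) × EuclideanSpace ℝ (Fin d) |
        p.2 ∉ S}.indicator 1 : _ → ℝ≥0∞) (rowTraj A α i (X ω) (fun j => w j ω) (k + 1)) :=
      (measurable_one.indicator hm).comp (hN.measurable_traj A α i (k + 1))
    filter_upwards [(lintegral_eq_zero_iff hmm).1 h] with ω hω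
    by_contra hcon
    simp [Set.indicator, hcon] at hω

end NoiseModel

end Row

end

noncomputable section

/-! ### Rates for one row: in expectation, and uniformly in time with high probability. -/

section RowBounds

variable {d : ℕ} {A : Matrix (Fin d) (Fin d) ℝ} {S : Set (EuclideanSpace ℝ (Fin d))}
  {Sg : EuclideanSpace ℝ (Fin d) →L[ℝ] EuclideanSpace ℝ (Fin d)}
  {u : EuclideanSpace ℝ (Fin d) → EuclideanSpace ℝ (Fin d) → EuclideanSpace ℝ (Fin d) → ℝ}
  {R B μ κ : ℝ}
  {Ω : Type*} [MeasurableSpace Ω] {P : Measure Ω} [IsProbabilityMeasure P]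
  {w : ℕ → Ω → EuclideanSpace ℝ (Fin d)}
  {X : Ω → EuclideanSpace ℝ (Fin d) × EuclideanSpace ℝ (Fin d)}

/-- The step sizes `a / (k + K)`. -/
def stepSize (a K : ℝ) (k : ℕ) : ℝ := a / ((k : ℝ) + K)

section StepSize

variable {a K : ℝ}

lemma stepSize_nonneg (ha : 0 ≤ a) (hK : 0 < K) (k : ℕ) : 0 ≤ stepSize a K k := by
  unfold stepSize; positivity

lemma stepSize_le (ha : 0 ≤ a) (hK : 0 < K) (k : ℕ) : stepSize a K k ≤ a / K := by
  unfold stepSize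
  gcongr
  linarith [(Nat.cast_nonneg k : (0 : ℝ) ≤ k)]

lemma stepSize_succ_le (ha : 0 ≤ a) (hK : 0 < K) (k : ℕ) :
    stepSize a K (k + 1) ≤ stepSize a K k := by
  unfold stepSize
  gcongr
  simp

/-- The decrement `a / (s(s+1))` is of the order of the squared step; `2 ≤ a * μ` supplies the
constant. -/
lemma stepSize_sub_le (ha : 2 ≤ a * μ) (ha0 : 0 ≤ a) (hK : 0 < K) (k : ℕ) :
    stepSize a K k - stepSize a K (k + 1) ≤ stepSize a K k ^ 2 * μ / 2 := by
  unfold stepSize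
  set s : ℝ := (k : ℝ) + K with hs
  have hs0 : 0 < s := by positivity
  have e : (((k + 1 : ℕ) : ℝ) + K) = s + 1 := by rw [hs]; push_cast; ring
  rw [e]
  have e1 : a / s - a / (s + 1) = a / (s * (s + 1)) := by field_simp; ring
  have e2 : (a / s) ^ 2 * μ / 2 = a * (a * μ / 2) / (s * s) := by field_simp
  rw [e1, e2]
  have h1 : a ≤ a * (a * μ / 2) := by nlinarith
  gcongr
  linarith

lemma smooth_stepSize (ha : 0 ≤ a) (hK : 0 < K) (_ : 0 ≤ R) (_ : 0 ≤ κ)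
    (hs : 56 * (a / K) * κ * R ^ 6 * B ^ 2 ≤ μ ^ 2) (k : ℕ) :
    56 * stepSize a K k * κ * R ^ 6 * B ^ 2 ≤ μ ^ 2 := by
  refine le_trans ?_ hs
  have := stepSize_le ha hK k
  gcongr

end StepSize

theorem DriftModel.lintegral_loss_le (h : DriftModel A (P.map (w 0)) S Sg u R B μ κ)
    (hN : NoiseModel P w X) (hS : MeasurableSet S) (i : Fin d) {a K D : ℝ} (ha0 : 0 ≤ a)
    (ha : 2 ≤ a * μ) (hK : 2 ≤ K) (haK : a ≤ K) (haμ : a * μ ≤ K) (hD : 0 ≤ D)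
    (hs : 56 * (a / K) * κ * R ^ 6 * B ^ 2 ≤ μ ^ 2)
    (hX : ∀ᵐ ω ∂P, (X ω).2 ∈ S) (hinit : ∀ᵐ ω ∂P, 1 / 2 * ⟪(X ω).1, Sg (X ω).1⟫ ≤ D) (k : ℕ) :
    ∫⁻ ω, ENNReal.ofReal (1 / 2 * ⟪(rowTraj A (stepSize a K) i (X ω) (fun j => w j ω) k).1,
      Sg (rowTraj A (stepSize a K) i (X ω) (fun j => w j ω) k).1⟫) ∂P ≤
    ENNReal.ofReal (10 / 9 * ((2 * K * D + a ^ 2 * (7 * κ * R ^ 6 * B ^ 2)) / (k + K))) := by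
  have hK0 : 0 < K := by linarith
  have hκ := h.one_le_κ
  have hR := h.one_le_R
  have hpν : IsProbabilityMeasure (P.map (w 0)) :=
    Measure.isProbabilityMeasure_map (hN.meas 0).aemeasurable
  set α := stepSize a K with hαdef
  set c := 7 * κ * R ^ 6 * B ^ 2 with hc
  have hc0 : 0 ≤ c := by positivity
  -- The first summand covers the initial value, since `2D ≥ 11/10 D`; the second makes `α_k² c ≤ M
  -- / s²` for `s = k + K`.
  set M := 2 * K * D + a ^ 2 * c with hM
  have hM0 : 0 ≤ M := by positivity
  have hα0 := fun k => stepSize_nonneg ha0 hK0 k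
  have hα1 : ∀ k, α k ≤ 1 := fun k => (stepSize_le ha0 hK0 k).trans ((div_le_one hK0).2 haK)
  have hsk := smooth_stepSize ha0 hK0 (by linarith) (by linarith) hs
  have hmem := hN.ae_mem α i hS h.mem hX
  have hΦ : ∀ k, Measurable fun p : EuclideanSpace ℝ (Fin d) × EuclideanSpace ℝ (Fin d) =>
      ENNReal.ofReal (lyap Sg u (α k) p.1 p.2) := fun k =>
    ENNReal.measurable_ofReal.comp (h.continuous_lyap (α k)).measurable
  have key : ∀ k : ℕ, ∫⁻ ω, ENNReal.ofReal (lyap Sg u (α k)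
      (rowTraj A α i (X ω) (fun j => w j ω) k).1 (rowTraj A α i (X ω) (fun j => w j ω) k).2) ∂P ≤
      ENNReal.ofReal (M / (k + K)) := by
    intro k
    induction k with
    | zero =>
      have : ∀ᵐ ω ∂P, ENNReal.ofReal (lyap Sg u (α 0)
          (rowTraj A α i (X ω) (fun j => w j ω) 0).1
          (rowTraj A α i (X ω) (fun j => w j ω) 0).2) ≤ ENNReal.ofReal (M / ((0 : ℕ) + K)) := by
        filter_upwards [hX, hinit] with ω hω hω'
        refine ENNReal.ofReal_le_ofReal ?_
        have h1 : lyap Sg u (α 0) (X ω).1 (X ω).2 ≤ _ := h.lyap_le hω (hα0 0) (hsk 0)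
        have h2 : 2 * D ≤ M / ((0 : ℕ) + K) := by
          rw [Nat.cast_zero, zero_add, le_div_iff₀ hK0, hM]
          have : 0 ≤ a ^ 2 * c := by positivity
          linarith
        change lyap Sg u (α 0) (X ω).1 (X ω).2 ≤ _
        linarith
      refine (lintegral_mono_ae this).trans ?_
      simp
    | succ k ih =>
      have hstep := hN.lintegral_step A α i k (hΦ (k + 1))
      rw [hstep]
      set s : ℝ := (k : ℝ) + K with hsdef
      have hs2 : 2 ≤ s := by
        have := (Nat.cast_nonneg k : (0 : ℝ) ≤ k); linarith
      have e : (((k + 1 : ℕ) : ℝ) + K) = s + 1 := by rw [hsdef]; push_cast; ring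
      have hαs : α k = a / s := rfl
      have hαμ : α k * μ ≤ 1 := by
        rw [hαs, div_mul_eq_mul_div, div_le_one (by linarith)]
        have := (Nat.cast_nonneg k : (0 : ℝ) ≤ k); linarith
      calc _ ≤ ∫⁻ ω, ENNReal.ofReal ((1 - α k * μ)) * ENNReal.ofReal (lyap Sg u (α k)
            (rowTraj A α i (X ω) (fun j => w j ω) k).1
            (rowTraj A α i (X ω) (fun j => w j ω) k).2) + ENNReal.ofReal (α k ^ 2 * c) ∂P := by
            refine lintegral_mono_ae ?_
            filter_upwards [hmem k] with ω hω
            rw [← ENNReal.ofReal_mul (by linarith), ← ENNReal.ofReal_add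
              (mul_nonneg (by linarith) (h.lyap_nonneg hω (hα0 k) (hsk k))) (by positivity)]
            exact h.lintegral_lyap_step_le i hω (hα0 (k + 1)) (stepSize_succ_le ha0 hK0 k)
              (hα1 k) (stepSize_sub_le ha ha0 hK0 k) (hsk k)
        _ = ENNReal.ofReal ((1 - α k * μ)) * ∫⁻ ω, ENNReal.ofReal (lyap Sg u (α k)
            (rowTraj A α i (X ω) (fun j => w j ω) k).1
            (rowTraj A α i (X ω) (fun j => w j ω) k).2) ∂P + ENNReal.ofReal (α k ^ 2 * c) := by
            rw [lintegral_add_right _ measurable_const, lintegral_const, measure_univ, mul_one,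
              lintegral_const_mul' _ _ ENNReal.ofReal_ne_top]
        _ ≤ ENNReal.ofReal ((1 - α k * μ)) * ENNReal.ofReal (M / s) +
            ENNReal.ofReal (α k ^ 2 * c) := by gcongr
        _ ≤ _ := by
            rw [← ENNReal.ofReal_mul (by linarith), ← ENNReal.ofReal_add
              (mul_nonneg (by linarith) (by positivity)) (by positivity), e]
            refine ENNReal.ofReal_le_ofReal ?_
            have h1 : 2 / s ≤ α k * μ := by
              rw [hαs, div_mul_eq_mul_div]; gcongr
            have h2 : α k ^ 2 * c ≤ M / s ^ 2 := by
              rw [hαs, div_pow, div_mul_eq_mul_div]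
              gcongr
              rw [hM]
              have : 0 ≤ 2 * K * D := by positivity
              linarith
            -- The contraction gains `2/s`; the noise spends `1/s` of it, and the other `1/s`
            -- suffices for the passage from `M/s` to `M/(s+1)`.
            calc (1 - α k * μ) * (M / s) + α k ^ 2 * c ≤ (1 - 2 / s) * (M / s) + M / s ^ 2 := by
                  gcongr
              _ = M * ((s - 1) / s ^ 2) := by field_simp; ring
              _ ≤ M * (1 / (s + 1)) := by
                  refine mul_le_mul_of_nonneg_left ?_ hM0
                  rw [div_le_div_iff₀ (by positivity) (by positivity)]
                  nlinarith
              _ = _ := by ring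
  calc _ ≤ ∫⁻ ω, ENNReal.ofReal (10 / 9) * ENNReal.ofReal (lyap Sg u (α k)
          (rowTraj A α i (X ω) (fun j => w j ω) k).1
          (rowTraj A α i (X ω) (fun j => w j ω) k).2) ∂P := by
        refine lintegral_mono_ae ?_
        filter_upwards [hmem k] with ω hω
        rw [← ENNReal.ofReal_mul (by norm_num)]
        refine ENNReal.ofReal_le_ofReal ?_
        have := h.le_lyap (e := (rowTraj A α i (X ω) (fun j => w j ω) k).1) hω (hα0 k) (hsk k)
        linarith
    _ = ENNReal.ofReal (10 / 9) * ∫⁻ ω, ENNReal.ofReal (lyap Sg u (α k)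
          (rowTraj A α i (X ω) (fun j => w j ω) k).1
          (rowTraj A α i (X ω) (fun j => w j ω) k).2) ∂P :=
        lintegral_const_mul' _ _ ENNReal.ofReal_ne_top
    _ ≤ _ := by
        rw [ENNReal.ofReal_mul (by norm_num)]
        gcongr
        exact key k

/-- The noise adds at most `1/(k+K+1)` to the exponent at each step, so `log((k+K)/K)` is a
sufficient compensator. -/
lemma one_div_succ_le_log_sub {K : ℝ} (hK : 1 ≤ K) (k : ℕ) :
    1 / ((k : ℝ) + K + 1) ≤ Real.log (((k + 1 : ℕ) + K) / K) - Real.log (((k : ℕ) + K) / K) := by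
  have hk := (Nat.cast_nonneg k : (0 : ℝ) ≤ k)
  have h0 : 0 < (k : ℝ) + K := by linarith
  rw [← Real.log_div (by positivity) (by positivity)]
  have e : (((k + 1 : ℕ) : ℝ) + K) / K / (((k : ℝ) + K) / K) = ((k : ℝ) + K + 1) / (k + K) := by
    push_cast
    field_simp
    ring
  rw [e]
  have h1 := Real.one_sub_inv_le_log_of_pos (x := ((k : ℝ) + K + 1) / (k + K)) (by positivity)
  refine le_trans (le_of_eq ?_) h1
  field_simp
  ring

/-- The absence of a violation at the current time (`hW`) bounds `‖e‖²`. The constant part of the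
amplitude is controlled by small `θ`; in the part with `‖e‖²` the factor `θ` cancels, and large `K`
is what makes it small. -/
lemma DriftModel.subgaussian_condition {ν : Measure (EuclideanSpace ℝ (Fin d))}
    (h : DriftModel A ν S Sg u R B μ κ) {a K θ b α s : ℝ} (ha0 : 0 ≤ a) (hK : 0 < K)
    (hKs : K ≤ s) (hs1 : 1 ≤ s) (hα : α = a / s)
    (hs : 56 * α * κ * R ^ 6 * B ^ 2 ≤ μ ^ 2) (hθ0 : 0 < θ) (hb : 0 ≤ b)
    (hθ2 : 32 * θ * a * B ^ 2 * R ^ 2 ≤ 1) (hb1 : 640 * κ ^ 2 * a * (b + 1) ≤ μ * K)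
    {e z : EuclideanSpace ℝ (Fin d)} (hz : z ∈ S)
    (hW : θ * s * lyap Sg u α e z ≤ b + Real.log (s / K)) :
    θ * (s + 1) * α * (B * R + 3 * κ * ‖e‖) ^ 2 ≤ 1 / 4 := by
  have hμ := h.pos
  have hκ := h.one_le_κ
  have hs0 : 0 < s := by linarith
  have hα0 : 0 ≤ α := by rw [hα]; positivity
  have p1 : θ * (s + 1) * α ≤ 2 * θ * a := by
    have : θ * (s + 1) * α = θ * a * ((s + 1) / s) := by rw [hα]; ring
    rw [this]
    have h1 : (s + 1) / s ≤ 2 := by rw [div_le_iff₀ hs0]; linarith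
    calc _ ≤ θ * a * 2 := by gcongr
      _ = _ := by ring
  have p2 : (B * R + 3 * κ * ‖e‖) ^ 2 ≤ 2 * (B * R) ^ 2 + 18 * κ ^ 2 * ‖e‖ ^ 2 := by
    have := sq_nonneg (B * R - 3 * κ * ‖e‖)
    linarith
  have p3 : θ * (s + 1) * α * (2 * (B * R) ^ 2) ≤ 1 / 8 := by
    calc _ ≤ 2 * θ * a * (2 * (B * R) ^ 2) := by gcongr
      _ = (32 * θ * a * B ^ 2 * R ^ 2) / 8 := by ring
      _ ≤ 1 / 8 := by gcongr
  -- Trading the logarithm for the linear factor `s / K` makes `s` cancel against `α = a / s`, so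
  -- the condition does not depend on time.
  have p5 : b + Real.log (s / K) ≤ s / K * (b + 1) := by
    have q1 : Real.log (s / K) ≤ s / K - 1 := Real.log_le_sub_one_of_pos (by positivity)
    have q2 : 1 ≤ s / K := by rw [one_le_div hK]; linarith
    have q3 := mul_le_mul_of_nonneg_right q2 hb
    linarith
  have p4 : μ * (θ * s * ‖e‖ ^ 2) ≤ 20 / 9 * (s / K * (b + 1)) := by
    have q1 := h.le_lyap (e := e) hz hα0 hs
    have q2 := h.lower e
    have q3 : μ * ‖e‖ ^ 2 ≤ 20 / 9 * lyap Sg u α e z := by linarith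
    have q4 := mul_le_mul_of_nonneg_left q3 (by positivity : 0 ≤ θ * s)
    linarith
  have p6 : θ * (s + 1) * α * (18 * κ ^ 2 * ‖e‖ ^ 2) ≤ 1 / 8 := by
    have q1 : μ * (θ * (s + 1) * α * (18 * κ ^ 2 * ‖e‖ ^ 2)) ≤ μ * (1 / 8) := by
      calc μ * (θ * (s + 1) * α * (18 * κ ^ 2 * ‖e‖ ^ 2)) ≤
            μ * (2 * θ * a * (18 * κ ^ 2 * ‖e‖ ^ 2)) := by gcongr
        _ = 36 * κ ^ 2 * (a / s) * (μ * (θ * s * ‖e‖ ^ 2)) := by field_simp; ring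
        _ ≤ 36 * κ ^ 2 * (a / s) * (20 / 9 * (s / K * (b + 1))) := by gcongr
        -- `36 · 20/9 = 80 = 640/8`.
        _ = (640 * κ ^ 2 * a * (b + 1)) / K / 8 := by field_simp; ring
        _ ≤ (μ * K) / K / 8 := by gcongr
        _ = _ := by field_simp
    exact le_of_mul_le_mul_left q1 hμ
  calc _ ≤ θ * (s + 1) * α * (2 * (B * R) ^ 2 + 18 * κ ^ 2 * ‖e‖ ^ 2) := by gcongr
    _ ≤ _ := by rw [mul_add]; linarith

lemma DriftModel.lintegral_exp_lyap_stepSize_le {ν : Measure (EuclideanSpace ℝ (Fin d))}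
    [IsProbabilityMeasure ν] (h : DriftModel A ν S Sg u R B μ κ) (i : Fin d) {a K θ b : ℝ}
    (ha0 : 0 ≤ a) (ha : 2 ≤ a * μ) (hK : 1 ≤ K) (haK : a ≤ K)
    (hs : 56 * (a / K) * κ * R ^ 6 * B ^ 2 ≤ μ ^ 2) (hθ0 : 0 < θ) (hb : 0 ≤ b)
    (hθ1 : 4 * θ * a ^ 2 * (7 * κ * R ^ 6 * B ^ 2) ≤ 1) (hθ2 : 32 * θ * a * B ^ 2 * R ^ 2 ≤ 1)
    (hb1 : 640 * κ ^ 2 * a * (b + 1) ≤ μ * K) {e z : EuclideanSpace ℝ (Fin d)} (hzS : z ∈ S)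
    (k : ℕ) (hW : θ * (k + K) * lyap Sg u (stepSize a K k) e z ≤ b + Real.log ((k + K) / K)) :
    ∫⁻ x, ENNReal.ofReal (Real.exp (θ * (k + K + 1) * lyap Sg u (stepSize a K (k + 1))
        (rowStep (stepSize a K k) e z (x i)) (matVec A z + x))) ∂ν ≤
      ENNReal.ofReal (Real.exp (θ * (k + K) * lyap Sg u (stepSize a K k) e z +
        1 / (k + K + 1))) := by
  have hK0 : 0 < K := by linarith
  have hκ := h.one_le_κ
  have hR := h.one_le_R
  have hc0 : 0 ≤ 7 * κ * R ^ 6 * B ^ 2 := by positivity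
  have hk := (Nat.cast_nonneg k : (0 : ℝ) ≤ k)
  set α := stepSize a K with hα
  set s : ℝ := (k : ℝ) + K with hsdef
  have hs1 : 1 ≤ s := by linarith
  have hs0 : 0 < s := by linarith
  have hαs : α k = a / s := rfl
  have hα0 := fun k => stepSize_nonneg ha0 hK0 k
  have hα1 : α k ≤ 1 := (stepSize_le ha0 hK0 k).trans ((div_le_one hK0).2 haK)
  have hsk := smooth_stepSize ha0 hK0 (by linarith) (by linarith) hs
  -- The increment of the weight is `θ`, and `α_k μ ≥ 2/s` makes the right side at least `θ`.
  have hl : θ * (s + 1) - θ * s ≤ θ * (s + 1) * α k * μ / 2 := by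
    have : θ * (s + 1) * α k * μ / 2 = θ * ((s + 1) / s) * (a * μ / 2) := by
      rw [hαs]; ring
    rw [this]
    have h1 : 1 ≤ (s + 1) / s := by rw [one_le_div hs0]; linarith
    have h2 : θ * 1 * 1 ≤ θ * ((s + 1) / s) * (a * μ / 2) := by gcongr; linarith
    linarith
  have hsub := h.subgaussian_condition ha0 hK0 (by linarith) hs1 hαs (hsk k) hθ0 hb hθ2 hb1 hzS hW
  refine (h.lintegral_exp_lyap_step_le i (e := e) (l := θ * s) (l' := θ * (s + 1)) hzS
    (hα0 (k + 1)) (stepSize_succ_le ha0 hK0 k) hα1 (stepSize_sub_le ha ha0 hK0 k) (hsk k)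
    (by positivity) hl hsub).trans (ENNReal.ofReal_le_ofReal (Real.exp_le_exp.2 ?_))
  have h1 : ((s + 1) / s) ^ 2 ≤ 2 ^ 2 := by
    gcongr; rw [div_le_iff₀ hs0]; linarith
  have h2 : θ * (s + 1) * (α k ^ 2 * (7 * κ * R ^ 6 * B ^ 2)) ≤ 1 / (s + 1) := by
    rw [hαs]
    calc θ * (s + 1) * ((a / s) ^ 2 * (7 * κ * R ^ 6 * B ^ 2)) =
        ((s + 1) / s) ^ 2 * (θ * a ^ 2 * (7 * κ * R ^ 6 * B ^ 2)) / (s + 1) := by field_simp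
      _ ≤ 2 ^ 2 * (θ * a ^ 2 * (7 * κ * R ^ 6 * B ^ 2)) / (s + 1) := by gcongr
      _ ≤ 1 / (s + 1) := by gcongr; linarith
  linarith

/-- The maximal inequality for `θ(k+K)V_k` with compensator `log((k+K)/K)`. The event `G` of no
violation up to time `k` depends on the past only and supplies the hypothesis of the exponential
step; `11/10 θKD` bounds the initial exponent. -/
theorem DriftModel.measure_exists_loss_gt_le
    (h : DriftModel A (P.map (w 0)) S Sg u R B μ κ)
    (hN : NoiseModel P w X) (hS : MeasurableSet S) (i : Fin d) {a K D θ b : ℝ} (ha0 : 0 ≤ a)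
    (ha : 2 ≤ a * μ) (hK : 1 ≤ K) (haK : a ≤ K)
    (hs : 56 * (a / K) * κ * R ^ 6 * B ^ 2 ≤ μ ^ 2) (hθ0 : 0 < θ) (hb : 0 ≤ b)
    (hθ1 : 4 * θ * a ^ 2 * (7 * κ * R ^ 6 * B ^ 2) ≤ 1) (hθ2 : 32 * θ * a * B ^ 2 * R ^ 2 ≤ 1)
    (hb1 : 640 * κ ^ 2 * a * (b + 1) ≤ μ * K)
    (hX : ∀ᵐ ω ∂P, (X ω).2 ∈ S) (hinit : ∀ᵐ ω ∂P, 1 / 2 * ⟪(X ω).1, Sg (X ω).1⟫ ≤ D) :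
    P {ω | ∃ k : ℕ, 10 / 9 * ((b + Real.log ((k + K) / K)) / (θ * (k + K))) <
        1 / 2 * ⟪(rowTraj A (stepSize a K) i (X ω) (fun j => w j ω) k).1,
          Sg (rowTraj A (stepSize a K) i (X ω) (fun j => w j ω) k).1⟫} ≤
      ENNReal.ofReal (Real.exp (11 / 10 * (θ * K * D) - b)) := by
  have hK0 : 0 < K := by linarith
  have hκ := h.one_le_κ
  have hR := h.one_le_R
  have hB := h.one_le_B
  have hμ := h.pos
  have hpν : IsProbabilityMeasure (P.map (w 0)) :=
    Measure.isProbabilityMeasure_map (hN.meas 0).aemeasurable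
  set α := stepSize a K with hαdef
  set c := 7 * κ * R ^ 6 * B ^ 2 with hc
  have hc0 : 0 ≤ c := by positivity
  have hα0 := fun k => stepSize_nonneg ha0 hK0 k
  have hα1 : ∀ k, α k ≤ 1 := fun k => (stepSize_le ha0 hK0 k).trans ((div_le_one hK0).2 haK)
  have hsk := smooth_stepSize ha0 hK0 (by linarith) (by linarith) hs
  have hmem := hN.ae_mem α i hS h.mem hX
  let Wf : ℕ → EuclideanSpace ℝ (Fin d) × EuclideanSpace ℝ (Fin d) → ℝ := fun k p =>
    θ * ((k : ℝ) + K) * lyap Sg u (α k) p.1 p.2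
  have hWm : ∀ k, Measurable (Wf k) := fun k =>
    (h.continuous_lyap (α k)).measurable.const_mul _
  let tr : ℕ → Ω → EuclideanSpace ℝ (Fin d) × EuclideanSpace ℝ (Fin d) := fun k ω =>
    rowTraj A α i (X ω) (fun j => w j ω) k
  have htr : ∀ k, Measurable (tr k) := fun k => hN.measurable_traj A α i k
  let sl : ℕ → ℝ := fun k => Real.log (((k : ℕ) + K) / K)
  have hsl0 : ∀ k, 0 ≤ sl k := fun k => Real.log_nonneg (by
    rw [one_le_div hK0]; linarith [(Nat.cast_nonneg k : (0 : ℝ) ≤ k)])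
  have hmax := measure_exists_lt_le (P := P) (V := fun k ω => Wf k (tr k ω))
    (fun k => (hWm k).comp (htr k)) sl b (by
      intro k
      let G : Set ((EuclideanSpace ℝ (Fin d) × EuclideanSpace ℝ (Fin d)) ×
        (ℕ → EuclideanSpace ℝ (Fin d))) :=
        {p | ∀ j ≤ k, Wf j (rowTraj A α i p.1 p.2 j) ≤ b + sl j}
      have hGm : MeasurableSet G := by
        have : G = ⋂ j, ⋂ _ : j ≤ k, {p | Wf j (rowTraj A α i p.1 p.2 j) ≤ b + sl j} := by
          ext; simp [G]
        rw [this]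
        exact MeasurableSet.iInter fun j => MeasurableSet.iInter fun _ =>
          measurableSet_le ((hWm j).comp (measurable_rowTraj A α i j)) measurable_const
      have hGk : ∀ x v, (x, truncSeq k v) ∈ G ↔ (x, v) ∈ G := by
        intro x v
        refine forall_congr' fun j => forall_congr' fun hj => ?_
        simp only [rowTraj_truncSeq A α i x v hj]
      have hΦ : Measurable fun p => ENNReal.ofReal (Real.exp (Wf (k + 1) p - sl (k + 1))) :=
        ENNReal.measurable_ofReal.comp (Real.measurable_exp.comp ((hWm (k + 1)).sub_const _))
      refine (hN.setLIntegral_step A α i k hGm hGk hΦ).le.trans ?_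
      have hGΩ : MeasurableSet {ω | (X ω, fun j => w j ω) ∈ G} :=
        (hN.meas_init.prodMk (measurable_pi_lambda _ hN.meas)) hGm
      refine lintegral_mono_ae ?_
      filter_upwards [ae_restrict_of_ae (hmem k), ae_restrict_mem hGΩ] with ω hω hωG
      have hW : Wf k (tr k ω) ≤ b + sl k := hωG k le_rfl
      set e := (tr k ω).1 with he
      set z := (tr k ω).2 with hz
      have hzS : z ∈ S := hω
      set s : ℝ := (k : ℝ) + K with hsdef
      have hk := (Nat.cast_nonneg k : (0 : ℝ) ≤ k)
      have hs1 : 1 ≤ s := by linarith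
      have hs0 : 0 < s := by linarith
      have es : (((k + 1 : ℕ) : ℝ) + K) = s + 1 := by rw [hsdef]; push_cast; ring
      have hWe : Wf k (tr k ω) = θ * s * lyap Sg u (α k) e z := rfl
      have hone := h.lintegral_exp_lyap_stepSize_le i (e := e) ha0 ha hK haK hs hθ0 hb hθ1 hθ2 hb1
        hzS k hW
      have hinc := one_div_succ_le_log_sub hK k
      rw [← hsdef] at hone hinc
      have hexp : ∀ x : EuclideanSpace ℝ (Fin d),
          ENNReal.ofReal (Real.exp (Wf (k + 1) (rowNext A (α k) i (tr k ω) x) - sl (k + 1))) =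
          ENNReal.ofReal (Real.exp (-sl (k + 1))) * ENNReal.ofReal (Real.exp (θ * (s + 1) *
            lyap Sg u (α (k + 1)) (rowStep (α k) e z (x i)) (matVec A z + x))) := by
        intro x
        rw [← ENNReal.ofReal_mul (by positivity), ← Real.exp_add]
        congr 2
        change θ * (((k + 1 : ℕ) : ℝ) + K) * lyap Sg u (α (k + 1)) (rowStep (α k) e z (x i))
          (matVec A z + x) - sl (k + 1) = _
        rw [es]; ring
      change ∫⁻ x, ENNReal.ofReal (Real.exp (Wf (k + 1) (rowNext A (α k) i (tr k ω) x) -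
        sl (k + 1))) ∂_ ≤ ENNReal.ofReal (Real.exp (Wf k (tr k ω) - sl k))
      simp_rw [hexp]
      rw [lintegral_const_mul' _ _ ENNReal.ofReal_ne_top]
      refine (mul_le_mul_right hone _).trans ?_
      rw [← ENNReal.ofReal_mul (by positivity), ← Real.exp_add, hWe]
      exact ENNReal.ofReal_le_ofReal (Real.exp_le_exp.2 (by linarith)))
  have hsub : P {ω | ∃ k : ℕ, 10 / 9 * ((b + Real.log ((k + K) / K)) / (θ * (k + K))) <
        1 / 2 * ⟪(tr k ω).1, Sg (tr k ω).1⟫} ≤ P {ω | ∃ k, b + sl k < Wf k (tr k ω)} := by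
    refine measure_mono_ae ?_
    filter_upwards [ae_all_iff.2 hmem] with ω hω
    rintro ⟨k, hk⟩
    refine ⟨k, ?_⟩
    have h1 := h.le_lyap (e := (tr k ω).1) (hω k) (hα0 k) (hsk k)
    have h2 : (b + sl k) / (θ * (k + K)) < lyap Sg u (α k) (tr k ω).1 (tr k ω).2 := by
      change 10 / 9 * ((b + sl k) / (θ * (k + K))) < _ at hk
      have h3 : 9 / 10 * (1 / 2 * ⟪(tr k ω).1, Sg (tr k ω).1⟫) ≤
        lyap Sg u (α k) (tr k ω).1 (tr k ω).2 := h1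
      linarith
    rw [div_lt_iff₀ (by positivity)] at h2
    change b + sl k < θ * ((k : ℝ) + K) * lyap Sg u (α k) (tr k ω).1 (tr k ω).2
    linarith
  refine hsub.trans (hmax.trans ?_)
  have hsl : sl 0 = 0 := by simp [sl, hK0.ne']
  have hY : ∫⁻ ω, ENNReal.ofReal (Real.exp (Wf 0 (tr 0 ω) - sl 0)) ∂P ≤
      ENNReal.ofReal (Real.exp (11 / 10 * (θ * K * D))) := by
    refine (lintegral_mono_ae (g := fun _ =>
      ENNReal.ofReal (Real.exp (11 / 10 * (θ * K * D)))) ?_).trans (by simp)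
    filter_upwards [hX, hinit] with ω hω hω'
    refine ENNReal.ofReal_le_ofReal (Real.exp_le_exp.2 ?_)
    rw [hsl, sub_zero]
    change θ * (((0 : ℕ) : ℝ) + K) * lyap Sg u (α 0) (X ω).1 (X ω).2 ≤ _
    have h1 := h.lyap_le (e := (X ω).1) hω (hα0 0) (hsk 0)
    calc _ ≤ θ * (((0 : ℕ) : ℝ) + K) * (11 / 10 * D) := by
          have : lyap Sg u (α 0) (X ω).1 (X ω).2 ≤ 11 / 10 * D := by linarith
          gcongr
      _ = _ := by push_cast; ring
  refine (mul_le_mul_right hY _).trans ?_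
  rw [← ENNReal.ofReal_mul (by positivity), ← Real.exp_add]
  exact ENNReal.ofReal_le_ofReal (Real.exp_le_exp.2 (by linarith))

end RowBounds

end

noncomputable section

/-! ### Construction of the approximate Poisson solution from the mixing time. -/

section Poisson

variable {d : ℕ}

lemma centredForm_bilin (Sg : EuclideanSpace ℝ (Fin d) →L[ℝ] EuclideanSpace ℝ (Fin d))
    (z x y x' y' : EuclideanSpace ℝ (Fin d)) (c : ℝ) :
    centredForm Sg z (x - c • x') (y - c • y') = centredForm Sg z x y -
      c * centredForm Sg z x' y - c * centredForm Sg z x y' + c ^ 2 * centredForm Sg z x' y' := by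
  simp only [centredForm, map_sub, map_smul, inner_sub_left, inner_sub_right,
    real_inner_smul_left, real_inner_smul_right]
  ring

lemma continuous_poissonForm (A : Matrix (Fin d) (Fin d) ℝ)
    (Sg : EuclideanSpace ℝ (Fin d) →L[ℝ] EuclideanSpace ℝ (Fin d)) (N : ℕ) :
    Continuous fun p : EuclideanSpace ℝ (Fin d) × EuclideanSpace ℝ (Fin d) ×
      EuclideanSpace ℝ (Fin d) => poissonForm A Sg N p.1 p.2.1 p.2.2 := by
  unfold poissonForm centredForm
  fun_prop

lemma exists_driftModel {A : Matrix (Fin d) (Fin d) ℝ}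
    {ν π : Measure (EuclideanSpace ℝ (Fin d))} [IsProbabilityMeasure ν] [IsProbabilityMeasure π]
    {R B μ : ℝ} {S : Set (EuclideanSpace ℝ (Fin d))} {t : ℕ} (hR1 : 1 ≤ R) (hB1 : 1 ≤ B)
    (hS : MeasurableSet S) (hne : S.Nonempty)
    (hSR : ∀ z ∈ S, ‖z‖ ≤ R) (hpS : ∀ z ∈ S, ∀ᵐ y ∂(ldsKernel A ν z), y ∈ S)
    (hB : ∀ᵐ w ∂ν, ‖w‖ ≤ B) (hmean : ∫ w, w ∂ν = 0)
    (hinv : Kernel.Invariant (ldsKernel A ν) π) (hmix : HasMixingTime (ldsKernel A ν) S π t)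
    (hpd : (secondMoment π).PosDef) (hμ : IsLeast (spectrum ℝ (secondMoment π)) μ) :
    ∃ n, DriftModel A ν S (secondMomentCLM π) (poissonForm A (secondMomentCLM π) (t * n))
      R B μ (4 * R ^ 2 * t) := by
  have hπS : ∀ᵐ z ∂π, z ∈ S := hmix.ae_mem hS hne hpS
  have hπR : ∀ᵐ z ∂π, ‖z‖ ≤ R := hπS.mono hSR
  have ht : 1 ≤ t := hmix.1
  have ht1 : (1 : ℝ) ≤ t := by exact_mod_cast ht
  have hμ0 : 0 < μ := by
    obtain ⟨i, hi⟩ : ∃ i, hpd.1.eigenvalues i = μ := by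
      have := hμ.1
      rwa [hpd.1.spectrum_real_eq_range_eigenvalues] at this
    rw [← hi]
    exact hpd.eigenvalues_pos i
  have hlow := fun x => le_inner_secondMomentCLM hpd hμ x
  have hμR : μ ≤ R ^ 2 := by
    -- A least eigenvalue exists, so the dimension is positive: in dimension zero the spectrum is
    -- empty.
    have hd : Nonempty (Fin d) := by
      by_contra hcon
      rw [not_nonempty_iff] at hcon
      have := hμ.1
      rw [spectrum.of_subsingleton] at this
      exact this
    obtain ⟨i⟩ := hd
    have h1 := hlow (EuclideanSpace.single i (1 : ℝ))
    have h2 := real_inner_le_norm (EuclideanSpace.single i (1 : ℝ))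
      (secondMomentCLM π (EuclideanSpace.single i (1 : ℝ)))
    have h3 := norm_secondMomentCLM_le hπR (EuclideanSpace.single i (1 : ℝ))
    simp only [PiLp.norm_single, norm_one, one_pow, mul_one, one_mul] at h1 h2 h3
    linarith
  -- Chosen so that the first omitted term, bounded by `2R² 2⁻ⁿ`, is at most `μ / 4`.
  obtain ⟨n, hn⟩ := exists_pow_lt_of_lt_one
    (show 0 < μ / (8 * R ^ 2) by positivity) (by norm_num : (1 / 2 : ℝ) < 1)
  refine ⟨n, ?_⟩
  have hpow := fun x y k z (hz : z ∈ S) =>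
    abs_centredForm_pow_le hS hSR hpS hπS hB hmean hinv hmix x y k hz
  constructor
  · exact hR1
  · exact hB1
  · exact hμ0
  · exact hμR
  · nlinarith [sq_nonneg R]
  · exact hSR
  · exact hB
  · exact hmean
  · exact fun z hz => (ae_ldsKernel_iff A ν z hS).1 (hpS z hz)
  · exact secondMomentCLM_symm hπR
  · exact norm_secondMomentCLM_le hπR
  · exact hlow
  · intro z x y x' y' c
    simp only [poissonForm, map_sub, map_smul, centredForm_bilin, Finset.sum_add_distrib,
      Finset.sum_sub_distrib, Finset.mul_sum]
  · exact continuous_poissonForm A _ _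
  · intro z hz x y
    calc _ ≤ ∑ k ∈ Finset.range (t * n), 2 * R ^ 2 * (1 / 2 : ℝ) ^ (k / t) * ‖x‖ * ‖y‖ :=
          (Finset.abs_sum_le_sum_abs _ _).trans (Finset.sum_le_sum fun k _ => hpow x y k z hz)
      _ = 2 * R ^ 2 * (∑ k ∈ Finset.range (t * n), (1 / 2 : ℝ) ^ (k / t)) * ‖x‖ * ‖y‖ := by
          rw [Finset.mul_sum, Finset.sum_mul, Finset.sum_mul]
      _ ≤ 2 * R ^ 2 * (2 * t) * ‖x‖ * ‖y‖ := by
          gcongr; exact sum_half_pow_div_le ht n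
      _ = _ := by ring
  · intro z hz x y
    have hint : ∀ x y, Integrable
        (fun w => centredForm (secondMomentCLM π) (matVec A z + w) x y) ν := by
      intro x y
      have hm : Measurable fun w : EuclideanSpace ℝ (Fin d) =>
          centredForm (secondMomentCLM π) (matVec A z + w) x y := by
        unfold centredForm; fun_prop
      refine Integrable.of_bound hm.aestronglyMeasurable (2 * R ^ 2 * 1 * ‖x‖ * ‖y‖) ?_
      filter_upwards [(ae_ldsKernel_iff A ν z hS).1 (hpS z hz)] with w hw
      simpa using hpow x y 0 _ hw
    have e : ∫ w, poissonForm A (secondMomentCLM π) (t * n) (matVec A z + w) x y ∂ν =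
        ∑ k ∈ Finset.range (t * n), centredForm (secondMomentCLM π) z
          (((matCLM A).adjoint ^ (k + 1)) x) (((matCLM A).adjoint ^ (k + 1)) y) := by
      simp only [poissonForm]
      rw [integral_finsetSum _ fun k _ => hint _ _]
      refine Finset.sum_congr rfl fun k _ => ?_
      rw [integral_centredForm_step hπR hB hmean hinv, pow_succ']
      rfl
    -- The kernel shifts the summation index by one, so the sums telescope and only the term of
    -- index `t * n` remains.
    have e2 : ∫ w, poissonForm A (secondMomentCLM π) (t * n) (matVec A z + w) x y ∂ν -
        (poissonForm A (secondMomentCLM π) (t * n) z x y - centredForm (secondMomentCLM π) z x y) =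
        centredForm (secondMomentCLM π) z
          (((matCLM A).adjoint ^ (t * n)) x) (((matCLM A).adjoint ^ (t * n)) y) := by
      have h1 := Finset.sum_range_succ (fun k => centredForm (secondMomentCLM π) z
          (((matCLM A).adjoint ^ k) x) (((matCLM A).adjoint ^ k) y)) (t * n)
      have h2 := Finset.sum_range_succ' (fun k => centredForm (secondMomentCLM π) z
          (((matCLM A).adjoint ^ k) x) (((matCLM A).adjoint ^ k) y)) (t * n)
      simp only [pow_zero] at h2
      change _ = _ + centredForm (secondMomentCLM π) z x y at h2
      rw [e]
      simp only [poissonForm]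
      linarith
    rw [e2]
    refine (hpow x y (t * n) z hz).trans ?_
    rw [Nat.mul_div_cancel_left n (by lia)]
    have h3 : 2 * R ^ 2 * (1 / 2 : ℝ) ^ n ≤ μ / 4 := by
      calc _ ≤ 2 * R ^ 2 * (μ / (8 * R ^ 2)) := by gcongr
        _ = μ / 4 := by field_simp; norm_num
    gcongr

end Poisson

/-! ### Reduction of the matrix recursion to its rows. -/

section Rows

variable {d : ℕ}

/-- The `i`-th row of a matrix as a vector of Euclidean space. -/
def rowVec (M : Matrix (Fin d) (Fin d) ℝ) (i : Fin d) : EuclideanSpace ℝ (Fin d) :=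
  WithLp.toLp 2 (M i)

lemma inner_rowVec (M : Matrix (Fin d) (Fin d) ℝ) (i : Fin d) (z : EuclideanSpace ℝ (Fin d)) :
    ⟪rowVec M i, z⟫ = matVec M z i := by
  simp [rowVec, matVec, PiLp.inner_apply, Matrix.toLpLin_apply, Matrix.mulVec, dotProduct, mul_comm]

lemma sysIdLoss_eq_sum {A : Matrix (Fin d) (Fin d) ℝ} {π : Measure (EuclideanSpace ℝ (Fin d))}
    [IsFiniteMeasure π] {R : ℝ} (hR : ∀ᵐ z ∂π, ‖z‖ ≤ R) (M : Matrix (Fin d) (Fin d) ℝ) :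
    sysIdLoss A π M = ∑ i, 1 / 2 * ⟪rowVec (M - A) i, secondMomentCLM π (rowVec (M - A) i)⟫ := by
  have e : ∀ z : EuclideanSpace ℝ (Fin d), ‖matVec M z - matVec A z‖ ^ 2 =
      ∑ i, ⟪rowVec (M - A) i, z⟫ * ⟪rowVec (M - A) i, z⟫ := by
    intro z
    have : matVec M z - matVec A z = matVec (M - A) z := by simp [matVec]
    rw [this, EuclideanSpace.real_norm_sq_eq]
    simp only [inner_rowVec, sq]
  simp_rw [sysIdLoss, e]
  rw [integral_finsetSum _ fun i _ => integrable_inner_mul_inner hR _ _, Finset.mul_sum]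
  simp_rw [inner_secondMomentCLM hR]

lemma rowTraj_eq (A A0 : Matrix (Fin d) (Fin d) ℝ) (a K : ℝ) (i : Fin d)
    (z0 : EuclideanSpace ℝ (Fin d)) (v : ℕ → EuclideanSpace ℝ (Fin d)) (k : ℕ) :
    rowTraj A (stepSize a K) i (rowVec (A0 - A) i, z0) v k =
      (rowVec (sysIdSGD a K A0 (ldsState A z0 v) k - A) i, ldsState A z0 v k) := by
  induction k with
  | zero => rfl
  | succ k ih =>
    rw [rowTraj_succ, ih]
    refine Prod.ext ?_ rfl
    simp only [rowNext, rowStep, inner_rowVec, stepSize, sysIdSGD]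
    ext j
    simp [rowVec, Matrix.vecMulVec, matVec, ldsState]
    ring

end Rows

end

/-! ### Arithmetic of the constants. -/

section Constants

/-- One lower bound on `K μ³` gives every smallness condition on the steps; `224 = 56 · 4` with `κ =
4R²t`, and surplus powers of `μ` are bounded through `μ ≤ R²`. -/
lemma stepSize_conditions {R B μ a ρ K t : ℝ} (hR : 1 ≤ R) (hB : 1 ≤ B) (hμ : 0 < μ)
    (hμR : μ ≤ R ^ 2) (ht : 1 ≤ t) (ha : 2 ≤ a * μ) (haρ : a * μ ≤ ρ)
    (hK : 224 * ρ * R ^ 8 * B ^ 2 * t ≤ K * μ ^ 3) :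
    0 ≤ a ∧ 2 ≤ K ∧ a ≤ K ∧ a * μ ≤ K ∧ 56 * (a / K) * (4 * R ^ 2 * t) * R ^ 6 * B ^ 2 ≤ μ ^ 2 := by
  have ha0 : 0 ≤ a := by
    by_contra hcon
    have : a * μ ≤ 0 := mul_nonpos_of_nonpos_of_nonneg (by linarith) hμ.le
    linarith
  have hρ : 2 ≤ ρ := ha.trans haρ
  have hB2 : 1 ≤ B ^ 2 := one_le_pow₀ hB
  have h1 : ρ * R ^ 8 ≤ K * μ ^ 3 := by
    refine le_trans ?_ hK
    calc ρ * R ^ 8 = 1 * ρ * R ^ 8 * 1 * 1 := by ring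
      _ ≤ 224 * ρ * R ^ 8 * B ^ 2 * t := by gcongr; norm_num
  have hK0 : 0 < K := by
    have : 0 < K * μ ^ 3 := lt_of_lt_of_le (by positivity) h1
    exact pos_of_mul_pos_left this (by positivity)
  have h2 : ρ * R ^ 2 ≤ K := by
    have : (ρ * R ^ 2) * R ^ 6 ≤ K * R ^ 6 := by
      calc _ = ρ * R ^ 8 := by ring
        _ ≤ K * μ ^ 3 := h1
        _ ≤ K * (R ^ 2) ^ 3 := by gcongr
        _ = _ := by ring
    exact le_of_mul_le_mul_right this (by positivity)
  have hR2 : 1 ≤ R ^ 2 := one_le_pow₀ hR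
  have h3 : ρ ≤ K := le_trans (by nlinarith) h2
  refine ⟨ha0, hρ.trans h3, ?_, haρ.trans h3, ?_⟩
  · have h4 : a * μ * μ ^ 2 ≤ K * μ * μ ^ 2 := by
      calc a * μ * μ ^ 2 ≤ ρ * (R ^ 2) ^ 2 := by gcongr
        _ = ρ * R ^ 4 := by ring
        _ ≤ ρ * R ^ 8 := by gcongr; norm_num
        _ ≤ K * μ ^ 3 := h1
        _ = _ := by ring
    have h5 := le_of_mul_le_mul_right h4 (by positivity)
    exact le_of_mul_le_mul_right h5 hμ
  · have h4 : 56 * (a / K) * (4 * R ^ 2 * t) * R ^ 6 * B ^ 2 =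
        224 * (a * μ) * R ^ 8 * B ^ 2 * t / (K * μ) := by field_simp; ring
    rw [h4, div_le_iff₀ (by positivity)]
    calc _ ≤ 224 * ρ * R ^ 8 * B ^ 2 * t := by gcongr
      _ ≤ _ := hK
      _ = _ := by ring

lemma half_le_log {x : ℝ} (hx : 2 ≤ x) : 1 / 2 ≤ Real.log x := by
  have h1 := Real.log_two_gt_d9
  have h2 := Real.log_le_log (by norm_num) hx
  linarith

/-- `θ` is a constant times the minimum of `μ²/t²`, which serves the one-step conditions, and `l/K`,
which keeps the initial exponent below `l`. The reciprocal of a minimum is at most the sum of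
reciprocals, whence the two summands of the rate. -/
lemma exists_exponent {R B D μ a ρ K t l : ℝ} (hR : 1 ≤ R) (hB : 1 ≤ B) (hμ : 0 < μ)
    (hμR : μ ≤ R ^ 2) (ht : 1 ≤ t) (hD : 1 ≤ D) (ha : 2 ≤ a * μ) (haρ : a * μ ≤ ρ) (hK0 : 0 < K)
    (hl0 : 0 < l) :
    ∃ θ : ℝ, 0 < θ ∧
      1 / θ ≤ 112 * ρ ^ 2 * R ^ 8 * B ^ 2 * D * (t ^ 2 / μ ^ 2 + K / l) ∧
      4 * θ * a ^ 2 * (7 * (4 * R ^ 2 * t) * R ^ 6 * B ^ 2) ≤ 1 ∧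
      32 * θ * a * B ^ 2 * R ^ 2 ≤ 1 ∧ 11 / 10 * (θ * K * D) ≤ l := by
  have hρ : 2 ≤ ρ := ha.trans haρ
  have ha0 : 0 ≤ a := by
    by_contra hcon
    have : a * μ ≤ 0 := mul_nonpos_of_nonpos_of_nonneg (by linarith) hμ.le
    linarith
  set c₀ := 1 / (112 * ρ ^ 2 * R ^ 8 * B ^ 2 * D) with hc0
  have hc0p : 0 < c₀ := by positivity
  have hc1 : c₀ * (112 * ρ ^ 2 * R ^ 8 * B ^ 2 * D) = 1 := by rw [hc0]; field_simp
  set θ := c₀ * min (μ ^ 2 / t ^ 2) (l / K) with hθ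
  have hθ0 : 0 < θ := by positivity
  have hθa : θ ≤ c₀ * (μ ^ 2 / t ^ 2) := by rw [hθ]; gcongr; exact min_le_left _ _
  have hθb : θ ≤ c₀ * (l / K) := by rw [hθ]; gcongr; exact min_le_right _ _
  have hθinv : 1 / θ ≤ 1 / c₀ * (t ^ 2 / μ ^ 2 + K / l) := by
    rw [hθ]
    rcases min_choice (μ ^ 2 / t ^ 2) (l / K) with hmin | hmin
    · rw [hmin]
      have e : 1 / (c₀ * (μ ^ 2 / t ^ 2)) = 1 / c₀ * (t ^ 2 / μ ^ 2 + 0) := by field_simp; simp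
      rw [e]; gcongr; positivity
    · rw [hmin]
      have e : 1 / (c₀ * (l / K)) = 1 / c₀ * (0 + K / l) := by field_simp; simp
      rw [e]; gcongr; positivity
  have hR1 : ∀ n : ℕ, 1 ≤ R ^ n := fun n => one_le_pow₀ hR
  have hB2 : 1 ≤ B ^ 2 := one_le_pow₀ hB
  have hρ2 : 2 ≤ ρ ^ 2 := by nlinarith
  have hθ1 : 4 * θ * a ^ 2 * (7 * (4 * R ^ 2 * t) * R ^ 6 * B ^ 2) ≤ 1 := by
    calc _ ≤ 4 * (c₀ * (μ ^ 2 / t ^ 2)) * a ^ 2 * (7 * (4 * R ^ 2 * t) * R ^ 6 * B ^ 2) := by gcongr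
      _ = c₀ * (112 * (a * μ) ^ 2 * R ^ 8 * B ^ 2 * (1 / t)) := by field_simp; ring
      _ ≤ c₀ * (112 * ρ ^ 2 * R ^ 8 * B ^ 2 * D) := by
        gcongr
        exact le_trans (by rw [div_le_one (by linarith)]; exact ht) hD
      _ = 1 := hc1
  have hθ2 : 32 * θ * a * B ^ 2 * R ^ 2 ≤ 1 := by
    calc _ ≤ 32 * (c₀ * (μ ^ 2 / t ^ 2)) * a * B ^ 2 * R ^ 2 := by gcongr
      _ = c₀ * (32 * (a * μ) * (μ * R ^ 2) * B ^ 2 * (1 / t ^ 2)) := by field_simp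
      _ ≤ c₀ * (112 * ρ ^ 2 * (R ^ 8) * B ^ 2 * D) := by
        gcongr
        · norm_num
        · nlinarith
        · calc μ * R ^ 2 ≤ R ^ 2 * R ^ 2 := by gcongr
            _ = R ^ 4 := by ring
            _ ≤ R ^ 8 := pow_le_pow_right₀ hR (by norm_num)
        · exact le_trans (by rw [div_le_one (by positivity)]; exact one_le_pow₀ ht) hD
      _ = 1 := hc1
  have hθl : 11 / 10 * (θ * K * D) ≤ l := by
    calc _ ≤ 11 / 10 * (c₀ * (l / K) * K * D) := by gcongr
      _ = c₀ * (11 / 10 * D) * l := by field_simp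
      _ ≤ c₀ * (112 * ρ ^ 2 * R ^ 8 * B ^ 2 * D) * l := by
        gcongr
        have : 1 * 1 * 1 ≤ ρ ^ 2 * R ^ 8 * B ^ 2 := by
          gcongr
          · linarith
          · exact hR1 8
        nlinarith
      _ = l := by rw [hc1, one_mul]
  exact ⟨θ, hθ0, by rwa [hc0, one_div_one_div] at hθinv, hθ1, hθ2, hθl⟩

lemma deviation_condition {R μ a ρ K t l b m : ℝ} (hμ : 0 < μ)
    (hμR : μ ≤ R ^ 2) (ha : 2 ≤ a * μ) (haρ : a * μ ≤ ρ) (hl0 : 0 ≤ l)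
    (hb : 0 ≤ b) (hm : 0 ≤ m) (h1 : b + 1 ≤ m * l)
    (h2 : (40960 * ρ * R ^ 6 * m) / 4 * t ^ 2 * l ≤ K * μ ^ 3) :
    640 * (4 * R ^ 2 * t) ^ 2 * a * (b + 1) ≤ μ * K := by
  have hρ : 0 ≤ ρ := by linarith
  have h3 : (640 * (4 * R ^ 2 * t) ^ 2 * a * (b + 1)) * μ ^ 2 ≤ (μ * K) * μ ^ 2 := by
    calc _ = 10240 * R ^ 4 * t ^ 2 * (a * μ) * (b + 1) * μ := by ring
      _ ≤ 10240 * R ^ 4 * t ^ 2 * ρ * (m * l) * R ^ 2 := by gcongr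
      _ = (40960 * ρ * R ^ 6 * m) / 4 * t ^ 2 * l := by ring
      _ ≤ K * μ ^ 3 := h2
      _ = _ := by ring
  exact le_of_mul_le_mul_right h3 (by positivity)

/-- The constant of the main theorem. -/
noncomputable def rateConst (d : ℕ) (R B D ρ : ℝ) : ℝ :=
  -- The first two summands serve the thresholds on `K`, with `1792 = 8 · 224`; the other two are
  -- the prefactors of the bound in expectation and of the deviation bound.
  1792 * ρ * R ^ 8 * B ^ 2 + 40960 * ρ * R ^ 6 * (2 * d + 4) +
    d * (10 / 9 * (2 * D + 28 * ρ ^ 2 * R ^ 8 * B ^ 2)) +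
    d * (10 / 9 * (2 * d + 3) * (112 * ρ ^ 2 * R ^ 8 * B ^ 2 * D))

end Constants

/-! ### Summation over rows, the union bound, and the main theorem. -/

section Main

variable {d : ℕ} {A : Matrix (Fin d) (Fin d) ℝ} {S : Set (EuclideanSpace ℝ (Fin d))}
  {Sg : EuclideanSpace ℝ (Fin d) →L[ℝ] EuclideanSpace ℝ (Fin d)}
  {u : EuclideanSpace ℝ (Fin d) → EuclideanSpace ℝ (Fin d) → EuclideanSpace ℝ (Fin d) → ℝ}
  {R B μ t : ℝ}
  {Ω : Type*} [MeasurableSpace Ω] {P : Measure Ω} [IsProbabilityMeasure P]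
  {w : ℕ → Ω → EuclideanSpace ℝ (Fin d)}
  {X : Fin d → Ω → EuclideanSpace ℝ (Fin d) × EuclideanSpace ℝ (Fin d)}

/-- Loss of the collection of all rows. -/
noncomputable def rowsLoss (A : Matrix (Fin d) (Fin d) ℝ)
    (Sg : EuclideanSpace ℝ (Fin d) →L[ℝ] EuclideanSpace ℝ (Fin d))
    (w : ℕ → Ω → EuclideanSpace ℝ (Fin d))
    (X : Fin d → Ω → EuclideanSpace ℝ (Fin d) × EuclideanSpace ℝ (Fin d)) (a K : ℝ) (k : ℕ)
    (ω : Ω) : ℝ :=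
  ∑ i, 1 / 2 * ⟪(rowTraj A (stepSize a K) i (X i ω) (fun j => w j ω) k).1,
    Sg (rowTraj A (stepSize a K) i (X i ω) (fun j => w j ω) k).1⟫

theorem integral_rowsLoss_le (h : DriftModel A (P.map (w 0)) S Sg u R B μ (4 * R ^ 2 * t))
    (hN : ∀ i, NoiseModel P w (X i)) (hS : MeasurableSet S) {a K D ρ : ℝ} (ht : 1 ≤ t)
    (hD : 1 ≤ D) (ha : 2 ≤ a * μ) (haρ : a * μ ≤ ρ)
    (hX : ∀ i, ∀ᵐ ω ∂P, (X i ω).2 ∈ S)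
    (hinit : ∀ i, ∀ᵐ ω ∂P, 1 / 2 * ⟪(X i ω).1, Sg (X i ω).1⟫ ≤ D)
    (hK : rateConst d R B D ρ * (t / μ ^ 3) < K) {k : ℕ} (hk : 1 ≤ k) :
    Integrable (rowsLoss A Sg w X a K k) P ∧ ∫ ω, rowsLoss A Sg w X a K k ω ∂P ≤
      rateConst d R B D ρ * (1 + K * μ ^ 2 / t) * (t / (μ ^ 2 * k)) := by
  have hR := h.one_le_R
  have hB := h.one_le_B
  have hμ := h.pos
  have hρ : 2 ≤ ρ := ha.trans haρ
  have hk1 : (1 : ℝ) ≤ k := by exact_mod_cast hk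
  obtain ⟨ha0, hK2, haK, haμ, hs⟩ := stepSize_conditions hR hB hμ h.le_sq ht ha haρ (K := K) (by
    rw [← mul_div_assoc, div_lt_iff₀ (by positivity)] at hK
    refine le_trans ?_ hK.le
    rw [rateConst]
    gcongr
    have h1 : 0 ≤ 40960 * ρ * R ^ 6 * (2 * d + 4) := by positivity
    have h2 : 0 ≤ d * (10 / 9 * (2 * D + 28 * ρ ^ 2 * R ^ 8 * B ^ 2)) := by positivity
    have h3 : 0 ≤ d * (10 / 9 * (2 * d + 3) * (112 * ρ ^ 2 * R ^ 8 * B ^ 2 * D)) := by positivity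
    have h4 : 0 ≤ ρ * R ^ 8 * B ^ 2 := by positivity
    linarith)
  set M := 10 / 9 * ((2 * K * D + a ^ 2 * (7 * (4 * R ^ 2 * t) * R ^ 6 * B ^ 2)) / (k + K)) with hM
  have hM0 : 0 ≤ M := by positivity
  let f : Fin d → Ω → ℝ := fun i ω =>
    1 / 2 * ⟪(rowTraj A (stepSize a K) i (X i ω) (fun j => w j ω) k).1,
      Sg (rowTraj A (stepSize a K) i (X i ω) (fun j => w j ω) k).1⟫
  have hf0 : ∀ i ω, 0 ≤ f i ω := fun i ω => by
    have := h.inner_nonneg (rowTraj A (stepSize a K) i (X i ω) (fun j => w j ω) k).1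
    simp only [f]; positivity
  have hfm : ∀ i, Measurable (f i) := fun i => by
    have := (hN i).measurable_traj A (stepSize a K) i k
    simp only [f]; fun_prop
  have hle : ∀ i, ∫⁻ ω, ENNReal.ofReal (f i ω) ∂P ≤ ENNReal.ofReal M := fun i =>
    h.lintegral_loss_le (hN i) hS i ha0 ha hK2 haK haμ (by linarith) hs (hX i) (hinit i) k
  have hfi : ∀ i, Integrable (f i) P := fun i => by
    refine ⟨(hfm i).aestronglyMeasurable, ?_⟩
    rw [hasFiniteIntegral_iff_ofReal (ae_of_all _ (hf0 i))]
    exact (hle i).trans_lt ENNReal.ofReal_lt_top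
  have hint : ∀ i, ∫ ω, f i ω ∂P ≤ M := fun i => by
    rw [integral_eq_lintegral_of_nonneg_ae (ae_of_all _ (hf0 i)) (hfm i).aestronglyMeasurable]
    exact ENNReal.toReal_le_of_le_ofReal hM0 (hle i)
  refine ⟨integrable_finsetSum _ fun i _ => hfi i, ?_⟩
  change ∫ ω, ∑ i, f i ω ∂P ≤ _
  rw [integral_finsetSum _ fun i _ => hfi i]
  refine (Finset.sum_le_sum fun i _ => hint i).trans ?_
  rw [Finset.sum_const, Finset.card_univ, Fintype.card_fin, nsmul_eq_mul]
  have ha2 : a ^ 2 ≤ ρ ^ 2 / μ ^ 2 := by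
    rw [le_div_iff₀ (by positivity), ← mul_pow]; gcongr
  have e1 : M ≤ 10 / 9 * (2 * D + 28 * ρ ^ 2 * R ^ 8 * B ^ 2) * ((K + t / μ ^ 2) / k) := by
    calc M ≤ 10 / 9 * ((2 * K * D + ρ ^ 2 / μ ^ 2 * (7 * (4 * R ^ 2 * t) * R ^ 6 * B ^ 2)) / k) := by
          rw [hM]; gcongr; linarith
      _ = 10 / 9 * ((2 * D * K + 28 * ρ ^ 2 * R ^ 8 * B ^ 2 * (t / μ ^ 2)) / k) := by ring
      _ ≤ 10 / 9 * ((2 * D * (K + t / μ ^ 2) +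
          28 * ρ ^ 2 * R ^ 8 * B ^ 2 * (K + t / μ ^ 2)) / k) := by
          gcongr
          · have : 0 ≤ t / μ ^ 2 := by positivity
            linarith
          · linarith
      _ = _ := by ring
  calc (d : ℝ) * M ≤ d * (10 / 9 * (2 * D + 28 * ρ ^ 2 * R ^ 8 * B ^ 2) *
        ((K + t / μ ^ 2) / k)) := by gcongr
    _ = d * (10 / 9 * (2 * D + 28 * ρ ^ 2 * R ^ 8 * B ^ 2)) * ((K + t / μ ^ 2) / k) := by ring
    _ ≤ rateConst d R B D ρ * ((K + t / μ ^ 2) / k) := by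
        gcongr
        rw [rateConst]
        have h1 : 0 ≤ 40960 * ρ * R ^ 6 * (2 * d + 4) := by positivity
        have h3 : 0 ≤ d * (10 / 9 * (2 * d + 3) * (112 * ρ ^ 2 * R ^ 8 * B ^ 2 * D)) := by
          positivity
        have h4 : 0 ≤ ρ * R ^ 8 * B ^ 2 := by positivity
        linarith
    _ = _ := by field_simp; ring

theorem measure_exists_rowsLoss_gt_le
    (h : DriftModel A (P.map (w 0)) S Sg u R B μ (4 * R ^ 2 * t))
    (hN : ∀ i, NoiseModel P w (X i)) (hS : MeasurableSet S) {a K D ρ δ : ℝ} (ht : 1 ≤ t)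
    (hD : 1 ≤ D) (ha : 2 ≤ a * μ) (haρ : a * μ ≤ ρ)
    (hX : ∀ i, ∀ᵐ ω ∂P, (X i ω).2 ∈ S)
    (hinit : ∀ i, ∀ᵐ ω ∂P, 1 / 2 * ⟪(X i ω).1, Sg (X i ω).1⟫ ≤ D) (hδ : 0 < δ) (hδ1 : δ < 1)
    (hK : rateConst d R B D ρ * (t ^ 2 / μ ^ 3) * Real.log (2 + t / μ) ^ 2 * Real.log (2 / δ) < K) :
    P {ω | ∃ k : ℕ, 1 ≤ k ∧ rateConst d R B D ρ * (1 + K * μ ^ 2 / (t ^ 2 * Real.log (2 / δ))) *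
      (t ^ 2 * Real.log (2 * k / δ) / (μ ^ 2 * k)) < rowsLoss A Sg w X a K k ω} ≤
      ENNReal.ofReal δ := by
  have hR := h.one_le_R
  have hB := h.one_le_B
  have hμ := h.pos
  have hμR := h.le_sq
  have hρ : 2 ≤ ρ := ha.trans haρ
  set l := Real.log (2 / δ) with hl
  have hl2 : 1 / 2 ≤ l := half_le_log (by rw [le_div_iff₀ hδ]; linarith)
  set C := rateConst d R B D ρ with hC
  have c1 : 0 ≤ 1792 * ρ * R ^ 8 * B ^ 2 := by positivity
  have c2 : 0 ≤ 40960 * ρ * R ^ 6 * (2 * d + 4) := by positivity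
  have c3 : 0 ≤ d * (10 / 9 * (2 * D + 28 * ρ ^ 2 * R ^ 8 * B ^ 2)) := by positivity
  have c4 : 0 ≤ d * (10 / 9 * (2 * d + 3) * (112 * ρ ^ 2 * R ^ 8 * B ^ 2 * D)) := by positivity
  have hC0 : 0 ≤ C := by rw [hC, rateConst]; linarith
  -- The squared logarithm enters only through its lower bound `1/4`.
  have hKl : C / 4 * t ^ 2 * l ≤ K * μ ^ 3 := by
    have h1 : (1 / 2 : ℝ) ^ 2 ≤ Real.log (2 + t / μ) ^ 2 := by
      have : 0 ≤ t / μ := by positivity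
      have := half_le_log (show 2 ≤ 2 + t / μ by linarith)
      gcongr
    have h2 : C * (t ^ 2 / μ ^ 3) * (1 / 2) ^ 2 * l ≤ K := le_trans (by gcongr) hK.le
    calc _ = C * (t ^ 2 / μ ^ 3) * (1 / 2) ^ 2 * l * μ ^ 3 := by field_simp; norm_num
      _ ≤ _ := by gcongr
  obtain ⟨ha0, hK2, haK, haμ, hs⟩ := stepSize_conditions hR hB hμ h.le_sq ht ha haρ (K := K) (by
    refine le_trans ?_ hKl
    calc 224 * ρ * R ^ 8 * B ^ 2 * t = (1792 * ρ * R ^ 8 * B ^ 2) / 4 * (t * 1) * (1 / 2) := by ring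
      _ ≤ C / 4 * (t * t) * l := by
        gcongr
        rw [hC, rateConst]; linarith
      _ = _ := by ring)
  have hK0 : 0 < K := by linarith
  -- Facts that need `d ≥ 1` are indexed by a row, so `d = 0` requires no separate case.
  have hd1 : ∀ i : Fin d, (1 : ℝ) ≤ d := fun i => by exact_mod_cast (by have := i.2; lia : 1 ≤ d)
  obtain ⟨θ, hθ0, hθinv, hθ1, hθ2, hθl⟩ := exists_exponent hR hB hμ hμR ht hD ha haρ hK0
    (by linarith : 0 < l)
  -- One `l` pays for the initial exponent, the other gives probability `δ/2`, and `log d` pays for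
  -- the union over rows.
  set b := 2 * l + Real.log d with hb
  have hlogd : ∀ _ : Fin d, 0 ≤ Real.log d := fun i => Real.log_nonneg (hd1 i)
  have hlogd' : ∀ _ : Fin d, Real.log d ≤ 2 * d * l := fun i => by
    have h1 := Real.log_le_sub_one_of_pos (show (0 : ℝ) < d by linarith [hd1 i])
    have h2 := hd1 i
    nlinarith
  have hb1 : ∀ _ : Fin d, 640 * (4 * R ^ 2 * t) ^ 2 * a * (b + 1) ≤ μ * K := fun i =>
    deviation_condition hμ hμR ha haρ (by linarith)
      (by have := hlogd i; rw [hb]; positivity) (by positivity)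
      (show b + 1 ≤ (2 * d + 4) * l by have := hlogd' i; rw [hb]; linarith)
      (by
        refine le_trans ?_ hKl
        gcongr
        rw [hC, rateConst]; linarith)
  have hrow := fun i => h.measure_exists_loss_gt_le (hN i) hS i ha0 ha (by linarith) haK hs hθ0
    (show 0 ≤ b by have := hlogd i; rw [hb]; positivity) hθ1 hθ2 (hb1 i) (hX i) (hinit i)
  have hexp : ∀ i : Fin d, Real.exp (11 / 10 * (θ * K * D) - b) ≤ δ / d := by
    intro i
    have hd0 : (0 : ℝ) < d := by linarith [hd1 i]
    calc _ ≤ Real.exp (-l - Real.log d) := Real.exp_le_exp.2 (by rw [hb]; linarith)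
      _ = (2 / δ)⁻¹ / d := by
        rw [Real.exp_sub, Real.exp_neg, Real.exp_log hd0, hl, Real.exp_log (by positivity)]
      _ ≤ δ / d := by
        gcongr
        rw [inv_div]; linarith
  set bad : Fin d → Set Ω := fun i =>
    {ω | ∃ k : ℕ, 10 / 9 * ((b + Real.log ((k + K) / K)) / (θ * (k + K))) <
        1 / 2 * ⟪(rowTraj A (stepSize a K) i (X i ω) (fun j => w j ω) k).1,
          Sg (rowTraj A (stepSize a K) i (X i ω) (fun j => w j ω) k).1⟫} with hbad
  have hsub : {ω | ∃ k : ℕ, 1 ≤ k ∧ C * (1 + K * μ ^ 2 / (t ^ 2 * l)) *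
      (t ^ 2 * Real.log (2 * k / δ) / (μ ^ 2 * k)) < rowsLoss A Sg w X a K k ω} ⊆ ⋃ i, bad i := by
    rintro ω ⟨k, hk, hω⟩
    by_contra hcon
    simp only [hbad, Set.mem_iUnion, Set.mem_ofPred_eq, not_exists, not_lt] at hcon
    refine absurd hω (not_lt.2 ?_)
    have hk1 : (1 : ℝ) ≤ k := by exact_mod_cast hk
    set Λ := Real.log (2 * k / δ) with hΛ
    have hlΛ : l ≤ Λ := Real.log_le_log (by positivity) (by gcongr; linarith)
    have hΛ0 : 0 ≤ Λ := by linarith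
    have hlog : Real.log ((k + K) / K) ≤ Λ := by
      refine Real.log_le_log (by positivity) ?_
      calc (k + K) / K = k / K + 1 := by field_simp
        _ ≤ k / 1 + k := by gcongr; linarith
        _ = 2 * k / 1 := by ring
        _ ≤ 2 * k / δ := by gcongr
    have hone : ∀ i : Fin d, 10 / 9 * ((b + Real.log ((k + K) / K)) / (θ * (k + K))) ≤
        10 / 9 * (2 * d + 3) * (112 * ρ ^ 2 * R ^ 8 * B ^ 2 * D * (t ^ 2 / μ ^ 2 + K / l)) * (Λ / k) := by
      intro i
      have h1 : b + Real.log ((k + K) / K) ≤ (2 * d + 3) * Λ := by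
        have h2 := hlogd' i
        have h3 : 2 * d * l ≤ 2 * d * Λ := by gcongr
        rw [hb]; linarith
      calc _ ≤ 10 / 9 * (((2 * d + 3) * Λ) / (θ * k)) := by gcongr; linarith
        _ = 10 / 9 * (2 * d + 3) * (1 / θ) * (Λ / k) := by field_simp
        _ ≤ _ := by gcongr
    calc rowsLoss A Sg w X a K k ω ≤ ∑ i : Fin d, 10 / 9 * (2 * d + 3) *
          (112 * ρ ^ 2 * R ^ 8 * B ^ 2 * D * (t ^ 2 / μ ^ 2 + K / l)) * (Λ / k) :=
          Finset.sum_le_sum fun i _ => (hcon i k).trans (hone i)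
      _ = d * (10 / 9 * (2 * d + 3) * (112 * ρ ^ 2 * R ^ 8 * B ^ 2 * D)) * ((t ^ 2 / μ ^ 2 + K / l) * (Λ / k)) := by
          rw [Finset.sum_const, Finset.card_univ, Fintype.card_fin, nsmul_eq_mul]; ring
      _ ≤ C * ((t ^ 2 / μ ^ 2 + K / l) * (Λ / k)) := by
          gcongr
          rw [hC, rateConst]; linarith
      _ = _ := by field_simp
  calc _ ≤ P (⋃ i, bad i) := measure_mono hsub
    _ ≤ ∑ i, P (bad i) := measure_iUnion_fintype_le _ _
    _ ≤ ∑ i : Fin d, ENNReal.ofReal (δ / d) :=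
        Finset.sum_le_sum fun i _ => (hrow i).trans (ENNReal.ofReal_le_ofReal (hexp i))
    _ = ENNReal.ofReal (∑ i : Fin d, δ / d) :=
        (ENNReal.ofReal_sum_of_nonneg fun i _ => by positivity).symm
    _ ≤ ENNReal.ofReal δ := by
        refine ENNReal.ofReal_le_ofReal ?_
        rw [Finset.sum_const, Finset.card_univ, Fintype.card_fin, nsmul_eq_mul]
        rw [mul_div_left_comm]
        exact mul_le_of_le_one_right hδ.le (div_self_le_one _)

end Main

theorem mainTheorem6 (d : ℕ) (R B D ρ : ℝ) :
    ∃ C : ℝ, 0 < C ∧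
    ∀ {Ω : Type*} [MeasurableSpace Ω] (P : Measure Ω) [IsProbabilityMeasure P]
      -- the linear system: stable matrix, i.i.d. centred bounded noise
      (Astar : Matrix (Fin d) (Fin d) ℝ) (w : ℕ → Ω → EuclideanSpace ℝ (Fin d))
      (Z₀ : Ω → EuclideanSpace ℝ (Fin d)) (A₀ : Ω → Matrix (Fin d) (Fin d) ℝ)
      (S : Set (EuclideanSpace ℝ (Fin d))) (π : Measure (EuclideanSpace ℝ (Fin d)))
      [IsProbabilityMeasure π] (μmin a : ℝ) (t : ℕ),
      IsStableMatrix Astar →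
      (∀ k, Measurable (w k)) → iIndepFun w P → (∀ k, IdentDistrib (w k) (w 0) P P) →
      (∀ k, ∫ ω, w k ω ∂P = 0) → (∀ k, ∀ᵐ ω ∂P, ‖w k ω‖ ≤ B) →
      -- initial state and initial iterate, independent of the noise
      Measurable Z₀ → Measurable (fun ω (i j : Fin d) => A₀ ω i j) →
      IndepFun (fun ω => ((fun i j => A₀ ω i j : Fin d → Fin d → ℝ), Z₀ ω))
        (fun ω (k : ℕ) => w k ω) P →
      -- compact state space of the chain, of radius at most `R`
      IsCompact S → (∀ z ∈ S, ‖z‖ ≤ R) → (∀ᵐ ω ∂P, Z₀ ω ∈ S) →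
      (∀ z ∈ S, ∀ᵐ z' ∂(ldsKernel Astar (P.map (w 0)) z), z' ∈ S) →
      -- stationary distribution, its second moment matrix, mixing time
      Kernel.Invariant (ldsKernel Astar (P.map (w 0))) π →
      (secondMoment π).PosDef → IsLeast (spectrum ℝ (secondMoment π)) μmin →
      HasMixingTime (ldsKernel Astar (P.map (w 0))) S π t →
      -- initial loss and stepsize parameter
      (∀ᵐ ω ∂P, sysIdLoss Astar π (A₀ ω) ≤ D) →
      2 / μmin ≤ a → a ≤ ρ / μmin →
      -- (a) the high-probability bound, uniform in time
      (∀ δ : ℝ, 0 < δ → δ < 1 → ∀ K₀ : ℝ,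
        C * ((t : ℝ) ^ 2 / μmin ^ 3) * Real.log (2 + t / μmin) ^ 2 * Real.log (2 / δ) < K₀ →
        1 - δ ≤ P.real {ω | ∀ k : ℕ, 1 ≤ k →
          sysIdLoss Astar π (sysIdSGD a K₀ (A₀ ω) (ldsState Astar (Z₀ ω) (fun j => w j ω)) k) ≤
            C * (1 + K₀ * μmin ^ 2 / ((t : ℝ) ^ 2 * Real.log (2 / δ))) *
              ((t : ℝ) ^ 2 * Real.log (2 * k / δ) / (μmin ^ 2 * k))}) ∧
      -- (b) the bound in expectation
      (∀ K₀ : ℝ, C * (t / μmin ^ 3) < K₀ → ∀ k : ℕ, 1 ≤ k →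
        Integrable (fun ω => sysIdLoss Astar π
          (sysIdSGD a K₀ (A₀ ω) (ldsState Astar (Z₀ ω) (fun j => w j ω)) k)) P ∧
        ∫ ω, sysIdLoss Astar π
          (sysIdSGD a K₀ (A₀ ω) (ldsState Astar (Z₀ ω) (fun j => w j ω)) k) ∂P ≤
            C * (1 + K₀ * μmin ^ 2 / t) * (t / (μmin ^ 2 * k))) := by
  -- The parameters are arbitrary reals; enlarging them preserves the hypotheses and makes the
  -- constant positive before any system is given.
  set R' := max R 1 with hR'
  set B' := max B 1 with hB'
  set D' := max D 1 with hD'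
  set ρ' := max ρ 2 with hρ'
  have hR1 : 1 ≤ R' := le_max_right _ _
  have hB1 : 1 ≤ B' := le_max_right _ _
  have hD1 : 1 ≤ D' := le_max_right _ _
  have hρ2 : 2 ≤ ρ' := le_max_right _ _
  refine ⟨rateConst d R' B' D' ρ', by rw [rateConst]; positivity, ?_⟩
  intro Ω _ P _ Astar w Z₀ A₀ S π _ μmin a t _ hw hind hid hmean hB hZ hA hAZw hS hSR hZS hpS hinv
    hpd hμ hmix hinit ha haρ
  have hν : IsProbabilityMeasure (P.map (w 0)) :=
    Measure.isProbabilityMeasure_map (hw 0).aemeasurable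
  have hSm : MeasurableSet S := hS.measurableSet
  obtain ⟨ω₀, hω₀⟩ := hZS.exists
  have hSR' : ∀ z ∈ S, ‖z‖ ≤ R' := fun z hz => (hSR z hz).trans (le_max_left _ _)
  obtain ⟨n, h⟩ := exists_driftModel (B := B') hR1 hB1 hSm ⟨_, hω₀⟩ hSR' hpS
    (by
      rw [ae_map_iff (hw 0).aemeasurable (measurableSet_le measurable_norm measurable_const)]
      filter_upwards [hB 0] with ω hω using hω.trans (le_max_left _ _))
    (by rw [integral_map (hw 0).aemeasurable (by fun_prop)]; exact hmean 0) hinv hmix hpd hμ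
  have hπR : ∀ᵐ z ∂π, ‖z‖ ≤ R' := (hmix.ae_mem hSm ⟨_, hω₀⟩ hpS).mono hSR'
  have hμ0 := h.pos
  have ht1 : (1 : ℝ) ≤ t := by exact_mod_cast hmix.1
  have ha2 : 2 ≤ a * μmin := by rwa [div_le_iff₀ hμ0] at ha
  have haρ2 : a * μmin ≤ ρ' := by
    rw [le_div_iff₀ hμ0] at haρ; exact haρ.trans (le_max_left _ _)
  let X : Fin d → Ω → EuclideanSpace ℝ (Fin d) × EuclideanSpace ℝ (Fin d) :=
    fun i ω => (rowVec (A₀ ω - Astar) i, Z₀ ω)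
  let φ : Fin d → (Fin d → Fin d → ℝ) × EuclideanSpace ℝ (Fin d) →
      EuclideanSpace ℝ (Fin d) × EuclideanSpace ℝ (Fin d) :=
    fun i p => (WithLp.toLp 2 (fun j => p.1 i j - Astar i j), p.2)
  have hφ : ∀ i, Measurable (φ i) := fun i => by
    refine Measurable.prodMk ?_ measurable_snd
    refine (WithLp.measurable_toLp 2 (Fin d → ℝ)).comp (measurable_pi_lambda _ fun j => ?_)
    exact ((measurable_pi_apply j).comp ((measurable_pi_apply i).comp measurable_fst)).sub_const _
  have hN : ∀ i, NoiseModel P w (X i) := fun i =>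
    { meas := hw
      indep := hind
      ident := hid
      meas_init := (hφ i).comp (hA.prodMk hZ)
      indep_init := hAZw.comp (hφ i) measurable_id }
  have hloss : ∀ K k ω, sysIdLoss Astar π
      (sysIdSGD a K (A₀ ω) (ldsState Astar (Z₀ ω) (fun j => w j ω)) k) =
      rowsLoss Astar (secondMomentCLM π) w X a K k ω := by
    intro K k ω
    rw [sysIdLoss_eq_sum hπR, rowsLoss]
    refine Finset.sum_congr rfl fun i _ => ?_
    rw [rowTraj_eq]
  have hinit' : ∀ i, ∀ᵐ ω ∂P, 1 / 2 * ⟪(X i ω).1, secondMomentCLM π (X i ω).1⟫ ≤ D' := by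
    intro i
    filter_upwards [hinit] with ω hω
    rw [sysIdLoss_eq_sum hπR] at hω
    refine le_trans ?_ (hω.trans (le_max_left _ _))
    exact Finset.single_le_sum
      (f := fun i => 1 / 2 * ⟪rowVec (A₀ ω - Astar) i, secondMomentCLM π (rowVec (A₀ ω - Astar) i)⟫)
      (fun j _ => mul_nonneg (by norm_num) (h.inner_nonneg _)) (Finset.mem_univ i)
  simp only [hloss]
  constructor
  · intro δ hδ hδ1 K hK
    have hbad := measure_exists_rowsLoss_gt_le h hN hSm ht1 hD1 ha2 haρ2 (fun _ => hZS) hinit'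
      hδ hδ1 hK
    set bad := {ω | ∃ k : ℕ, 1 ≤ k ∧ rateConst d R' B' D' ρ' *
      (1 + K * μmin ^ 2 / ((t : ℝ) ^ 2 * Real.log (2 / δ))) *
      ((t : ℝ) ^ 2 * Real.log (2 * k / δ) / (μmin ^ 2 * k)) <
        rowsLoss Astar (secondMomentCLM π) w X a K k ω} with hbadd
    set good := {ω | ∀ k : ℕ, 1 ≤ k → rowsLoss Astar (secondMomentCLM π) w X a K k ω ≤
      rateConst d R' B' D' ρ' * (1 + K * μmin ^ 2 / ((t : ℝ) ^ 2 * Real.log (2 / δ))) *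
      ((t : ℝ) ^ 2 * Real.log (2 * k / δ) / (μmin ^ 2 * k))} with hgood
    -- Subadditivity on a cover gives `P(good) ≥ 1 - P(bad)` without measurability of either set.
    have hcover : Set.univ ⊆ good ∪ bad := by
      intro ω _
      by_cases hω : ω ∈ good
      · exact Or.inl hω
      · refine Or.inr ?_
        simp only [hgood, Set.mem_ofPred_eq, not_forall, not_le] at hω
        obtain ⟨k, hk, hlt⟩ := hω
        exact ⟨k, hk, hlt⟩
    have h1 : (1 : ℝ) ≤ P.real good + P.real bad := by
      rw [← probReal_univ (μ := P)]
      exact (measureReal_mono hcover).trans (measureReal_union_le _ _)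
    have h2 : P.real bad ≤ δ := ENNReal.toReal_le_of_le_ofReal hδ.le hbad
    linarith
  · intro K hK k hk
    exact integral_rowsLoss_le h hN hSm ht1 hD1 ha2 haρ2 (fun _ => hZS) hinit' hK hk
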